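/- Let $d\ge 1$, let $\mathcal S_d$ be the Euclidean unit sphere of $\mathbb R^{d+1}$, with the distance inherited from $\mathbb R^{d+1}$, and let $\sigma$ be the normalized Lebesgue measure on $\mathcal S_d$. For a (real- or complex-valued) $f\in L^1(\mathcal S_d)=L^1(\mathcal S_d,\sigma)$ let $$P[f](x)=\int_{\mathcal S_d}\frac{1-\|x\|^2}{\|x-\xi\|^{d+1}}\,f(\xi)\,d\sigma(\xi)\qquad(\|x\|<1)$$ be its Poisson integral, and for $\beta\in\mathbb R$ let $$E(\beta,f)=\Big\{y\in\mathcal S_d:\ \limsup_{r\to1^-}\frac{\log|P[f](ry)|}{-\log(1-r)}=\beta\Big\}\qquad(\log 0=-\infty).$$ Then for quasi-all $f\in L^1(\mathcal S_d)$, that is, for all $f$ in a residual subset of $L^1(\mathcal S_d)$ (one that contains a dense $G_\delta$ set, for the norm topology), one has, simultaneously for every $\beta\in[0,d]$, $$\dim_{\mathcal H}\big(E(\beta,f)\big)=d-\beta,$$ where $\dim_{\mathcal H}$ denotes the Hausdorff dimension (with $\dim_{\mathcal H}\varnothing=0$). -/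

import Mathlib

open MeasureTheory Filter Topology Set

noncomputable section

namespace BallPoisson

/-- The Euclidean unit sphere `S_d` of `ℝ^(d+1)`, with the distance inherited from `ℝ^(d+1)`. -/
abbrev Sphere (d : ℕ) : Type :=
  Metric.sphere (0 : EuclideanSpace ℝ (Fin (d + 1))) 1

/-- The normalized Lebesgue (surface) measure `σ` on `S_d`, of total mass one. -/
def surfaceMeasure (d : ℕ) : Measure (Sphere d) :=
  ((volume : Measure (EuclideanSpace ℝ (Fin (d + 1)))).toSphere univ)⁻¹ •
    (volume : Measure (EuclideanSpace ℝ (Fin (d + 1)))).toSphere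

/-- The Poisson kernel `P(x, ξ) = (1 - ‖x‖²) / ‖x - ξ‖^(d+1)` of the unit ball of `ℝ^(d+1)`. -/
def poissonKernel (d : ℕ) (x : EuclideanSpace ℝ (Fin (d + 1))) (ξ : Sphere d) : ℝ :=
  (1 - ‖x‖ ^ 2) / ‖x - (ξ : EuclideanSpace ℝ (Fin (d + 1)))‖ ^ (d + 1)

/-- The Poisson integral `P[f](x) = ∫ P(x, ξ) f(ξ) dσ(ξ)` of `f ∈ L¹(S_d)` (real or complex
valued). For `‖x‖ < 1` the integrand is integrable, the kernel being bounded in `ξ`. -/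
def poissonIntegral {𝕜 : Type*} [RCLike 𝕜] (d : ℕ) (f : Lp 𝕜 1 (surfaceMeasure d))
    (x : EuclideanSpace ℝ (Fin (d + 1))) : 𝕜 :=
  ∫ ξ, poissonKernel d x ξ • f ξ ∂(surfaceMeasure d)

/-- The radial growth exponent `limsup_{r → 1⁻} log |P[f](r y)| / (-log (1 - r))`, an extended
real number. The logarithm is the extended one, so that `log 0 = -∞`. -/
def growthExponent {𝕜 : Type*} [RCLike 𝕜] (d : ℕ) (f : Lp 𝕜 1 (surfaceMeasure d))
    (y : Sphere d) : EReal :=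
  limsup (fun r : ℝ =>
    ENNReal.log ‖poissonIntegral d f (r • (y : EuclideanSpace ℝ (Fin (d + 1))))‖ₑ /
      ((-Real.log (1 - r) : ℝ) : EReal)) (𝓝[<] (1 : ℝ))

/-- The level set `E(β, f)` of the radial growth exponent. -/
def levelSet {𝕜 : Type*} [RCLike 𝕜] (d : ℕ) (β : ℝ) (f : Lp 𝕜 1 (surfaceMeasure d)) :
    Set (Sphere d) :=
  {y | growthExponent d f y = (β : EReal)}

end BallPoisson

end

/-! Upper bound, valid for every `f`. If the measure ν = |f|σ satisfies ν(B(y, ρ)) ≤ A ρ^(d-γ) at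
all scales, summing the kernel over dyadic annuli gives |P[f]((1-δ)y)| ≤ C A δ^(-γ). So where the
growth exponent exceeds γ, arbitrarily small balls have ν-mass at least ρ^(d-γ), and a Vitali
covering bounds the dimension of such points by d-γ (`dimH_growthExponent_gt_le`).

Lower bound for 0 < β < d. Place an average of 2^(nd) normalized bumps on tiny caps around the
dyadic points of order n. At depth δ above a point that is δ-close to a dyadic point its Poisson
integral is at least about 2^(-nd) δ^(-d), which equals δ^(-β) for δ = 2^(-αn) and α = d/(d-β). By
Baire category a generic f is, for infinitely many n, extremely close to such a comb divided by n+1,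
plus a function with Poisson integral bounded by n. The growth exponent is then at least β at every
point α-approximable by dyadics of infinitely many of these orders.

The admissible orders depend on f and may be very sparse. Instead of a mass transference principle,
an explicit map spreads binary digits so as to leave long gaps at chosen orders; its inverse is
Hölder of every exponent below 1/α (`exists_dyadic_approximable_map`). Applied coordinatewise and
followed by a central projection, it carries the unit cube into the approximable points. The upper
bound makes Lebesgue-null the set of parameters whose exponent exceeds β, so `le_dimH_levelSet` gets
dimension at least d-β for the exact level set.

For β = 0 the comb no longer dominates, and it is enough that P[f] is not polynomially small on a
set of positive measure; a second generic condition provides this. Neither condition involves β, so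
a single residual set serves all β. For β = d the lower bound is trivial. -/

/-! ### Dimension bounds from lower estimates of the mass of balls -/

/-- A set at each of whose points a finite measure charges arbitrarily small balls at least as much
as the `s`-th power of their radius has Hausdorff dimension at most `s`. -/
theorem dimH_le_of_frequently_rpow_le_measureReal_closedBall {X : Type*} [MetricSpace X]
    [MeasurableSpace X] [BorelSpace X] (ν : Measure X) [IsFiniteMeasure ν] {s : ℝ} (hs : 0 < s)
    {A : Set X}
    (hA : ∀ y ∈ A, ∀ ρ₀ > 0, ∃ ρ, 0 < ρ ∧ ρ < ρ₀ ∧ ρ ^ s ≤ ν.real (Metric.closedBall y ρ)) :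
    dimH A ≤ ENNReal.ofReal s := by
  have key : ∀ n : ℕ, ∃ u : Set (X × ℝ), u.Countable ∧
      (∀ a ∈ u, 0 < a.2 ∧ a.2 < 1 / ((n : ℝ) + 1) ∧
        a.2 ^ s ≤ ν.real (Metric.closedBall a.1 a.2)) ∧
      (u.PairwiseDisjoint fun a => Metric.closedBall a.1 a.2) ∧
      A ⊆ ⋃ a : u, Metric.closedBall a.1.1 (5 * a.1.2) := by
    intro n
    set t : Set (X × ℝ) := {a | 0 < a.2 ∧ a.2 < 1 / ((n : ℝ) + 1) ∧
        a.2 ^ s ≤ ν.real (Metric.closedBall a.1 a.2)} with ht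
    obtain ⟨u, hut, hdisj, hcov⟩ :=
      Vitali.exists_disjoint_subfamily_covering_enlargement_closedBall t (fun a => a.1)
        (fun a => a.2) (1 / ((n : ℝ) + 1)) (fun a ha => ha.2.1.le) 5 (by norm_num)
    refine ⟨u, ?_, fun a ha => hut ha, hdisj, ?_⟩
    -- Disjoint balls of positive mass under a finite measure are countably many.
    · have h1 : {i : u | 0 < ν (Metric.closedBall i.1.1 i.1.2)}.Countable := by
        refine Measure.countable_meas_pos_of_disjoint_iUnion
          (fun i => Metric.isClosed_closedBall.measurableSet) ?_
        intro i j hij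
        exact hdisj i.2 j.2 (fun h => hij (Subtype.ext h))
      have h2 : {i : u | 0 < ν (Metric.closedBall i.1.1 i.1.2)} = univ := by
        ext i
        simp only [mem_ofPred_eq, mem_univ, iff_true]
        have h3 := hut i.2
        have h4 : 0 < ν.real (Metric.closedBall i.1.1 i.1.2) :=
          lt_of_lt_of_le (Real.rpow_pos_of_pos h3.1 s) h3.2.2
        exact ((ENNReal.toReal_pos_iff).1 h4).1
      rw [h2, countable_univ_iff] at h1
      exact h1
    · intro y hy
      obtain ⟨ρ, h0, h1, h2⟩ := hA y hy (1 / ((n : ℝ) + 1)) (by positivity)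
      obtain ⟨b, hb, hsub⟩ := hcov (y, ρ) ⟨h0, h1, h2⟩
      exact mem_iUnion.2 ⟨⟨b, hb⟩, hsub (Metric.mem_closedBall_self h0.le)⟩
  choose u hcount hu hdisj hcov using key
  have : ∀ n, Countable (u n) := fun n => (hcount n).to_subtype
  -- The fivefold enlarged balls have diameter at most 10ρ, and (10ρ)^s ≤ 10^s ν(B); disjointness
  -- lets these masses sum to at most the total mass.
  have hbound : Measure.hausdorffMeasure s A ≤ ENNReal.ofReal (10 ^ s) * ν univ := by
    have hr : Tendsto (fun n : ℕ => ENNReal.ofReal (10 * (1 / ((n : ℝ) + 1)))) atTop (𝓝 0) := by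
      rw [← ENNReal.ofReal_zero]
      refine ENNReal.tendsto_ofReal ?_
      simpa using (tendsto_one_div_add_atTop_nhds_zero_nat (𝕜 := ℝ)).const_mul 10
    have hdiam : ∀ n, ∀ a : u n, Metric.ediam (Metric.closedBall a.1.1 (5 * a.1.2)) ≤
        ENNReal.ofReal (10 * a.1.2) := by
      intro n a
      refine Metric.ediam_le_of_forall_dist_le fun x hx y hy => ?_
      have := dist_triangle_right x y a.1.1
      rw [Metric.mem_closedBall] at hx hy
      linarith
    refine (Measure.hausdorffMeasure_le_liminf_tsum s A _ hr
      (fun n (a : u n) => Metric.closedBall a.1.1 (5 * a.1.2)) ?_ ?_).trans ?_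
    · refine Eventually.of_forall fun n a => (hdiam n a).trans (ENNReal.ofReal_le_ofReal ?_)
      have := (hu n a.1 a.2).2.1
      linarith
    · exact Eventually.of_forall fun n => hcov n
    · refine liminf_le_of_le (by isBoundedDefault) ?_
      intro b hb
      obtain ⟨n, hn⟩ := hb.exists
      refine hn.trans ?_
      calc ∑' a : u n, Metric.ediam (Metric.closedBall a.1.1 (5 * a.1.2)) ^ s
          ≤ ∑' a : u n, ENNReal.ofReal (10 ^ s) * ν (Metric.closedBall a.1.1 a.1.2) := by
            refine ENNReal.tsum_le_tsum fun a => ?_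
            have ha := hu n a.1 a.2
            calc Metric.ediam (Metric.closedBall a.1.1 (5 * a.1.2)) ^ s
                ≤ ENNReal.ofReal (10 * a.1.2) ^ s := ENNReal.rpow_le_rpow (hdiam n a) hs.le
              _ = ENNReal.ofReal (10 ^ s * a.1.2 ^ s) := by
                  rw [ENNReal.ofReal_rpow_of_pos (by linarith [ha.1]),
                    Real.mul_rpow (by norm_num) ha.1.le]
              _ ≤ ENNReal.ofReal (10 ^ s * ν.real (Metric.closedBall a.1.1 a.1.2)) := by
                  refine ENNReal.ofReal_le_ofReal ?_
                  exact mul_le_mul_of_nonneg_left ha.2.2 (by positivity)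
              _ = _ := by
                  rw [ENNReal.ofReal_mul (by positivity), ofReal_measureReal]
        _ = ENNReal.ofReal (10 ^ s) * ∑' a : u n, ν (Metric.closedBall a.1.1 a.1.2) :=
            ENNReal.tsum_mul_left
        _ = ENNReal.ofReal (10 ^ s) * ν (⋃ a : u n, Metric.closedBall a.1.1 a.1.2) := by
            rw [measure_iUnion]
            · intro i j hij
              exact hdisj n i.2 j.2 (fun h => hij (Subtype.ext h))
            · exact fun i => Metric.isClosed_closedBall.measurableSet
        _ ≤ _ := by gcongr; exact subset_univ _
  have hne : Measure.hausdorffMeasure ((s.toNNReal : NNReal) : ℝ) A ≠ ⊤ := by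
    rw [Real.coe_toNNReal _ hs.le]
    exact (hbound.trans_lt (ENNReal.mul_lt_top ENNReal.ofReal_lt_top (measure_lt_top _ _))).ne
  exact dimH_le_of_hausdorffMeasure_ne_top hne

/-! ### Surface measure of caps -/

namespace BallPoisson

instance (d : ℕ) : IsFiniteMeasure (surfaceMeasure d) := by
  constructor
  rw [surfaceMeasure, Measure.smul_apply, smul_eq_mul]
  refine ENNReal.mul_lt_top ?_ (measure_lt_top _ _)
  rw [ENNReal.inv_lt_top, pos_iff_ne_zero, Measure.measure_univ_ne_zero]
  exact Measure.toSphere_ne_zero _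

instance (d : ℕ) : (surfaceMeasure d).IsOpenPosMeasure := by
  constructor
  intro U hU hne
  rw [surfaceMeasure, Measure.smul_apply, smul_eq_mul]
  exact mul_ne_zero (ENNReal.inv_ne_zero.2 (measure_ne_top _ _)) (hU.measure_ne_zero _ hne)

open scoped Pointwise in
/-- A cone of height one over a spherical cap is covered by Euclidean balls centred on its axis. -/
theorem Ioo_smul_cap_subset {d : ℕ} (y : Sphere d) {ρ : ℝ} (hρ : 0 < ρ) :
    Ioo (0 : ℝ) 1 • (((↑) : Sphere d → EuclideanSpace ℝ (Fin (d + 1))) '' Metric.closedBall y ρ) ⊆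
      ⋃ k ∈ Finset.range (⌊1 / ρ⌋₊ + 1),
        Metric.closedBall (((k : ℝ) * ρ) • (y : EuclideanSpace ℝ (Fin (d + 1)))) (2 * ρ) := by
  rintro z ⟨t, ⟨ht0, ht1⟩, _, ⟨ξ, hξ, rfl⟩, rfl⟩
  simp only [mem_iUnion, exists_prop]
  refine ⟨⌊t / ρ⌋₊, ?_, ?_⟩
  · rw [Finset.mem_range, Nat.lt_succ_iff]
    exact Nat.floor_le_floor (by gcongr)
  · rw [Metric.mem_closedBall, dist_eq_norm]
    have h1 : (⌊t / ρ⌋₊ : ℝ) * ρ ≤ t := by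
      rw [← le_div_iff₀ hρ]; exact Nat.floor_le (by positivity)
    have h2 : t < ((⌊t / ρ⌋₊ : ℝ) + 1) * ρ := by
      rw [← div_lt_iff₀ hρ]; exact Nat.lt_floor_add_one _
    have hy : ‖(y : EuclideanSpace ℝ (Fin (d + 1)))‖ = 1 := by simp
    have h3 : t • (ξ : EuclideanSpace ℝ (Fin (d + 1))) - ((⌊t / ρ⌋₊ : ℝ) * ρ) • (y : EuclideanSpace ℝ (Fin (d + 1)))
        = t • ((ξ : EuclideanSpace ℝ (Fin (d + 1))) - y) + (t - (⌊t / ρ⌋₊ : ℝ) * ρ) • (y : EuclideanSpace ℝ (Fin (d + 1))) := by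
      module
    have h4 : ‖(ξ : EuclideanSpace ℝ (Fin (d + 1))) - y‖ ≤ ρ := by
      rw [← dist_eq_norm, ← Subtype.dist_eq]; exact hξ
    change ‖t • (ξ : EuclideanSpace ℝ (Fin (d + 1))) - _‖ ≤ _
    rw [h3]
    refine (norm_add_le _ _).trans ?_
    rw [norm_smul, norm_smul, hy, Real.norm_eq_abs, Real.norm_eq_abs, abs_of_pos ht0,
      abs_of_nonneg (by linarith)]
    nlinarith [norm_nonneg ((ξ : EuclideanSpace ℝ (Fin (d + 1))) - y)]

-- Up to normalization the measure of a cap is d+1 times the volume of the cone over it. About 1/ρ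
-- balls of radius 2ρ cover this cone, with total volume of order ρ^d; for ρ ≥ 1 the total mass
-- suffices.
open scoped Pointwise in
theorem exists_surfaceMeasure_closedBall_le (d : ℕ) :
    ∃ A : ℝ, 0 < A ∧ ∀ (y : Sphere d) (ρ : ℝ), 0 < ρ →
      (surfaceMeasure d).real (Metric.closedBall y ρ) ≤ A * ρ ^ d := by
  set V : Measure (EuclideanSpace ℝ (Fin (d + 1))) := volume
  set c : ℝ := ((V.toSphere univ)⁻¹).toReal
  set v : ℝ := V.real (Metric.ball 0 1)
  have hc : 0 ≤ c := ENNReal.toReal_nonneg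
  have hv : 0 ≤ v := measureReal_nonneg
  set m : ℝ := (surfaceMeasure d).real univ
  refine ⟨c * (d + 1) * (2 * 2 ^ (d + 1) * v) + m + 1, by positivity, fun y ρ hρ => ?_⟩
  have hm : 0 ≤ m := measureReal_nonneg
  rcases le_or_gt 1 ρ with h1 | h1
  · calc (surfaceMeasure d).real (Metric.closedBall y ρ) ≤ m * 1 := by
          rw [mul_one]; exact measureReal_mono (subset_univ _)
      _ ≤ _ := by
          refine mul_le_mul ?_ (one_le_pow₀ h1) zero_le_one (by positivity)
          have : 0 ≤ c * (d + 1) * (2 * 2 ^ (d + 1) * v) := by positivity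
          linarith
  · have hcone := measureReal_mono (μ := V) (Ioo_smul_cap_subset y hρ) (by
      refine ((measure_biUnion_finset_le _ _).trans_lt ?_).ne
      exact ENNReal.sum_lt_top.2 fun k _ => measure_closedBall_lt_top)
    have hsum : V.real (⋃ k ∈ Finset.range (⌊1 / ρ⌋₊ + 1),
        Metric.closedBall (((k : ℝ) * ρ) • (y : EuclideanSpace ℝ (Fin (d + 1)))) (2 * ρ))
        ≤ (2 / ρ) * ((2 * ρ) ^ (d + 1) * v) := by
      refine (measureReal_biUnion_finset_le _ _).trans ?_
      have : ∀ k ∈ Finset.range (⌊1 / ρ⌋₊ + 1), V.real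
          (Metric.closedBall (((k : ℝ) * ρ) • (y : EuclideanSpace ℝ (Fin (d + 1)))) (2 * ρ)) =
          (2 * ρ) ^ (d + 1) * v := by
        intro k _
        rw [measureReal_def, Measure.addHaar_closedBall _ _ (by positivity), ENNReal.toReal_mul,
          ENNReal.toReal_ofReal (by positivity)]
        simp [v, measureReal_def]
      rw [Finset.sum_congr rfl this, Finset.sum_const, nsmul_eq_mul, Finset.card_range]
      refine mul_le_mul_of_nonneg_right ?_ (by positivity)
      push_cast
      have h2 : (⌊1 / ρ⌋₊ : ℝ) ≤ 1 / ρ := Nat.floor_le (by positivity)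
      have h3 : 1 ≤ 1 / ρ := by rw [le_div_iff₀ hρ]; linarith
      have h4 : 2 / ρ = 1 / ρ + 1 / ρ := by ring
      linarith
    have heq : (surfaceMeasure d).real (Metric.closedBall y ρ) = c * ((d + 1) *
        V.real (Ioo (0 : ℝ) 1 • (((↑) : Sphere d → EuclideanSpace ℝ (Fin (d + 1))) ''
          Metric.closedBall y ρ))) := by
      rw [measureReal_def, surfaceMeasure, Measure.smul_apply, smul_eq_mul,
        Measure.toSphere_apply' _ Metric.isClosed_closedBall.measurableSet, ENNReal.toReal_mul,
        ENNReal.toReal_mul]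
      have h5 : ((Module.finrank ℝ (EuclideanSpace ℝ (Fin (d + 1))) : ENNReal)).toReal = d + 1 := by
        simp [ENNReal.toReal_add]
      rw [h5]
      rfl
    rw [heq]
    calc c * ((d + 1) * V.real (Ioo (0 : ℝ) 1 • (((↑) : Sphere d → EuclideanSpace ℝ (Fin (d + 1))) ''
          Metric.closedBall y ρ))) ≤ c * ((d + 1) * ((2 / ρ) * ((2 * ρ) ^ (d + 1) * v))) := by
          gcongr
          exact hcone.trans hsum
      _ = c * (d + 1) * (2 * 2 ^ (d + 1) * v) * ρ ^ d := by
          rw [mul_pow, pow_succ ρ]; field_simp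
      _ ≤ _ := by
          refine mul_le_mul_of_nonneg_right ?_ (by positivity)
          linarith

end BallPoisson

/-! ### Spreading binary digits -/

noncomputable section

namespace BallPoisson

/-- The integer formed by the first `k` binary digits of `x`. -/
def binaryPrefix (x : ℝ) (k : ℕ) : ℤ := ⌊2 ^ k * x⌋

/-- The `k`-th binary digit of `x` (counted from `0`) after the binary point. -/
def binaryDigit (x : ℝ) (k : ℕ) : ℤ := binaryPrefix x (k + 1) - 2 * binaryPrefix x k

theorem binaryDigit_nonneg (x : ℝ) (k : ℕ) : 0 ≤ binaryDigit x k := by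
  rw [binaryDigit, sub_nonneg, binaryPrefix, binaryPrefix, Int.le_floor, pow_succ]
  push_cast
  linarith [Int.floor_le (2 ^ k * x)]

theorem binaryDigit_le_one (x : ℝ) (k : ℕ) : binaryDigit x k ≤ 1 := by
  have : binaryPrefix x (k + 1) < 2 * binaryPrefix x k + 2 := by
    rw [binaryPrefix, binaryPrefix, Int.floor_lt, pow_succ]
    push_cast
    linarith [Int.lt_floor_add_one (2 ^ k * x)]
  rw [binaryDigit]
  omega

theorem binaryPrefix_zero {x : ℝ} (hx : x ∈ Ico (0 : ℝ) 1) : binaryPrefix x 0 = 0 := by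
  simpa [binaryPrefix, Int.floor_eq_zero_iff] using hx

/-- The real number obtained from `x ∈ [0, 1)` by moving its `l`-th binary digit to the position
`p l`. -/
def spreadDigits (p : ℕ → ℕ) (x : ℝ) : ℝ := ∑' l, (binaryDigit x l : ℝ) * (1 / 2) ^ (p l + 1)

variable {p : ℕ → ℕ}

theorem summable_half_pow_comp (hp : StrictMono p) :
    Summable fun l => ((1 : ℝ) / 2) ^ (p l + 1) := by
  have := (summable_geometric_two).comp_injective
    (i := fun l => p l + 1) (fun a b h => hp.injective (by simpa using h))
  exact this

theorem summable_spreadDigits (hp : StrictMono p) (x : ℝ) :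
    Summable fun l => (binaryDigit x l : ℝ) * (1 / 2) ^ (p l + 1) := by
  refine Summable.of_nonneg_of_le (fun l => ?_) (fun l => ?_) (summable_half_pow_comp hp)
  · exact mul_nonneg (by exact_mod_cast binaryDigit_nonneg x l) (by positivity)
  · have : (binaryDigit x l : ℝ) ≤ 1 := by exact_mod_cast binaryDigit_le_one x l
    exact mul_le_of_le_one_left (by positivity) this

theorem spreadDigits_tail_nonneg (x : ℝ) (k : ℕ) :
    0 ≤ ∑' l, (binaryDigit x (l + k) : ℝ) * (1 / 2) ^ (p (l + k) + 1) :=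
  tsum_nonneg fun l => mul_nonneg (by exact_mod_cast binaryDigit_nonneg x _) (by positivity)

theorem spreadDigits_tail_le (hp : StrictMono p) (x : ℝ) (k : ℕ) :
    ∑' l, (binaryDigit x (l + k) : ℝ) * (1 / 2) ^ (p (l + k) + 1) ≤ (1 / 2) ^ p k := by
  have hgeo : HasSum (fun l : ℕ => ((1 : ℝ) / 2) ^ (p k + 1) * (1 / 2) ^ l)
      ((1 / 2) ^ (p k + 1) * 2) := hasSum_geometric_two.mul_left _
  have hle : ∀ l, (binaryDigit x (l + k) : ℝ) * (1 / 2) ^ (p (l + k) + 1) ≤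
      (1 / 2) ^ (p k + 1) * (1 / 2) ^ l := by
    intro l
    have h1 : (binaryDigit x (l + k) : ℝ) ≤ 1 := by exact_mod_cast binaryDigit_le_one x _
    have h2 : p k + l ≤ p (l + k) := by
      have := hp.add_le_nat l k; omega
    calc _ ≤ ((1 : ℝ) / 2) ^ (p (l + k) + 1) := mul_le_of_le_one_left (by positivity) h1
      _ ≤ (1 / 2) ^ (p k + 1 + l) :=
        pow_le_pow_of_le_one (by norm_num) (by norm_num) (by omega)
      _ = _ := by rw [pow_add]
  have hs := (summable_nat_add_iff k).2 (summable_spreadDigits hp x)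
  calc _ ≤ ((1 : ℝ) / 2) ^ (p k + 1) * 2 := hasSum_le hle hs.hasSum hgeo
    _ = _ := by rw [pow_succ]; ring

theorem spreadDigits_eq (hp : StrictMono p) (x : ℝ) (k : ℕ) :
    spreadDigits p x = ∑ l ∈ Finset.range k, (binaryDigit x l : ℝ) * (1 / 2) ^ (p l + 1) +
      ∑' l, (binaryDigit x (l + k) : ℝ) * (1 / 2) ^ (p (l + k) + 1) :=
  ((summable_spreadDigits hp x).sum_add_tsum_nat_add k).symm

/-- Passing to one more digit doubles the difference of prefixes and adds the difference of the new
digits. Since `p` increases strictly, the weight of a position is at least twice that of the next,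
so moved digits separate at least as well. -/
theorem binaryPrefix_sub_le (hp : StrictMono p) {x y : ℝ} (hx : x ∈ Ico (0 : ℝ) 1)
    (hy : y ∈ Ico (0 : ℝ) 1) (k : ℕ) (h : 0 ≤ binaryPrefix y (k + 1) - binaryPrefix x (k + 1)) :
    ((binaryPrefix y (k + 1) - binaryPrefix x (k + 1) : ℤ) : ℝ) * (1 / 2) ^ (p k + 1) ≤
      ∑ l ∈ Finset.range (k + 1), (binaryDigit y l : ℝ) * (1 / 2) ^ (p l + 1) -
      ∑ l ∈ Finset.range (k + 1), (binaryDigit x l : ℝ) * (1 / 2) ^ (p l + 1) := by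
  induction k with
  | zero =>
    simp only [zero_add, Finset.range_one, Finset.sum_singleton, binaryDigit,
      binaryPrefix_zero hx, binaryPrefix_zero hy]
    push_cast
    linarith
  | succ k ih =>
    have hx1 := binaryDigit_nonneg x (k + 1)
    have hy1 := binaryDigit_le_one y (k + 1)
    have hxd : binaryPrefix x (k + 1 + 1) = 2 * binaryPrefix x (k + 1) + binaryDigit x (k + 1) := by
      rw [binaryDigit]; ring
    have hyd : binaryPrefix y (k + 1 + 1) = 2 * binaryPrefix y (k + 1) + binaryDigit y (k + 1) := by
      rw [binaryDigit]; ring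
    -- The new digits differ by at most one, so a nonnegative difference of the longer prefixes
    -- forces one for the shorter prefixes.
    have hD : 0 ≤ binaryPrefix y (k + 1) - binaryPrefix x (k + 1) := by omega
    have h1 := ih hD
    have h2 : ((1 : ℝ) / 2) ^ (p (k + 1) + 1) * 2 ≤ (1 / 2) ^ (p k + 1) := by
      have := hp (Nat.lt_succ_self k)
      calc ((1 : ℝ) / 2) ^ (p (k + 1) + 1) * 2 = (1 / 2) ^ (p (k + 1)) := by rw [pow_succ]; ring
        _ ≤ _ := pow_le_pow_of_le_one (by norm_num) (by norm_num) this
    have hD' : (0 : ℝ) ≤ ((binaryPrefix y (k + 1) - binaryPrefix x (k + 1) : ℤ) : ℝ) := by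
      exact_mod_cast hD
    have h3 := mul_le_mul_of_nonneg_left h2 hD'
    rw [Finset.sum_range_succ _ (k + 1), Finset.sum_range_succ _ (k + 1), hxd, hyd]
    push_cast at *
    nlinarith

/-- Two numbers at a distance more than `2 ^ (-k)` have images at a distance at least `2 ^ (-p k)`,
up to index shifts. -/
theorem half_pow_le_spreadDigits_sub (hp : StrictMono p) {x y : ℝ} (hx : x ∈ Ico (0 : ℝ) 1)
    (hy : y ∈ Ico (0 : ℝ) 1) (k : ℕ) (h : (1 / 2) ^ k < y - x) :
    (1 / 2) ^ (p k + 1) ≤ spreadDigits p y - spreadDigits p x := by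
  -- A difference of two is needed: one unit is lost to the tail of `x`, the other is the separation
  -- obtained.
  have h2 : 2 ≤ binaryPrefix y (k + 1) - binaryPrefix x (k + 1) := by
    have h3 : (2 : ℝ) < 2 ^ (k + 1) * y - 2 ^ (k + 1) * x := by
      have : (2 : ℝ) = 2 ^ (k + 1) * (1 / 2) ^ k := by
        rw [pow_succ, mul_right_comm, ← mul_pow]; norm_num
      rw [← mul_sub]
      nth_rw 1 [this]
      gcongr
    have h4 := Int.floor_le (2 ^ (k + 1) * x)
    have h5 := Int.lt_floor_add_one (2 ^ (k + 1) * y)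
    have h6 : ((binaryPrefix x (k + 1) : ℤ) : ℝ) + 1 < binaryPrefix y (k + 1) := by
      rw [binaryPrefix, binaryPrefix]; linarith
    have : binaryPrefix x (k + 1) + 1 < binaryPrefix y (k + 1) := by exact_mod_cast h6
    omega
  have h3 := binaryPrefix_sub_le hp hx hy k (by omega)
  rw [spreadDigits_eq hp x (k + 1), spreadDigits_eq hp y (k + 1)]
  have h4 := spreadDigits_tail_nonneg (p := p) y (k + 1)
  have h5 := spreadDigits_tail_le hp x (k + 1)
  have h6 : ((1 : ℝ) / 2) ^ p (k + 1) ≤ (1 / 2) ^ (p k + 1) :=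
    pow_le_pow_of_le_one (by norm_num) (by norm_num) (hp (Nat.lt_succ_self k))
  have h7 : (2 : ℝ) * (1 / 2) ^ (p k + 1) ≤
      ((binaryPrefix y (k + 1) - binaryPrefix x (k + 1) : ℤ) : ℝ) * (1 / 2) ^ (p k + 1) := by
    gcongr
    exact_mod_cast h2
  linarith

/-- Truncating `spreadDigits p x` at a gap of `p` gives a dyadic number close to it. -/
theorem exists_dyadic_near_spreadDigits (hp : StrictMono p) (x : ℝ) (k : ℕ) :
    ∃ j : ℕ, j < 2 ^ (p k + 1) ∧
      |spreadDigits p x - j * (1 / 2) ^ (p k + 1)| ≤ (1 / 2) ^ p (k + 1) := by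
  have key : ∀ k : ℕ, ∃ j : ℕ, j < 2 ^ (p k + 1) ∧
      ∑ l ∈ Finset.range (k + 1), (binaryDigit x l : ℝ) * (1 / 2) ^ (p l + 1) =
        j * (1 / 2) ^ (p k + 1) := by
    intro k
    have hdig : ∀ l, ∃ b : ℕ, b ≤ 1 ∧ (binaryDigit x l : ℝ) = b := by
      intro l
      obtain ⟨b, hb⟩ := Int.eq_ofNat_of_zero_le (binaryDigit_nonneg x l)
      have := binaryDigit_le_one x l
      exact ⟨b, by omega, by rw [hb]; simp⟩
    induction k with
    | zero =>
      obtain ⟨b, hb, hb'⟩ := hdig 0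
      refine ⟨b, hb.trans_lt (Nat.one_lt_two_pow (by omega)), by simp [hb']⟩
    | succ k ih =>
      obtain ⟨j, hj, hj'⟩ := ih
      obtain ⟨b, hb, hb'⟩ := hdig (k + 1)
      have hlt := hp (Nat.lt_succ_self k)
      obtain ⟨m, hm⟩ := Nat.exists_eq_add_of_lt hlt
      have hm' : p (k + 1) = p k + m + 1 := hm
      refine ⟨j * 2 ^ (m + 1) + b, ?_, ?_⟩
      · have h1 : 2 ^ (p (k + 1) + 1) = 2 ^ (p k + 1) * 2 ^ (m + 1) := by
          rw [← pow_add]; congr 1; omega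
        have h2 : (j + 1) * 2 ^ (m + 1) ≤ 2 ^ (p k + 1) * 2 ^ (m + 1) :=
          Nat.mul_le_mul_right _ hj
        have h3 : 1 < 2 ^ (m + 1) := Nat.one_lt_two_pow (by omega)
        rw [h1]
        nlinarith
      · rw [Finset.sum_range_succ, hj', hb']
        have h1 : ((1 : ℝ) / 2) ^ (p k + 1) = 2 ^ (m + 1) * (1 / 2) ^ (p (k + 1) + 1) := by
          have : p (k + 1) + 1 = (m + 1) + (p k + 1) := by omega
          rw [this, pow_add (1 / 2 : ℝ) (m + 1), ← mul_assoc, ← mul_pow]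
          norm_num
        rw [h1]
        push_cast
        ring
  obtain ⟨j, hj, hj'⟩ := key k
  refine ⟨j, hj, ?_⟩
  rw [spreadDigits_eq hp x (k + 1), hj', add_sub_cancel_left,
    abs_of_nonneg (spreadDigits_tail_nonneg x (k + 1))]
  exact spreadDigits_tail_le hp x (k + 1)

open Classical in
/-- Positions of digits leaving, at infinitely many sparse elements `n` of `I`, the gap between `n`
and `α * n`. -/
def gapPosition (I : Set ℕ) (α : ℝ) : ℕ → ℕ
  | 0 => 0
  | i + 1 =>
    if gapPosition I α i + 1 ∈ I ∧ (gapPosition I α i - i) ^ 2 ≤ i then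
      ⌈α * ((gapPosition I α i : ℝ) + 1)⌉₊
    else gapPosition I α i + 1

theorem gapPosition_strictMono (I : Set ℕ) {α : ℝ} (hα : 1 ≤ α) : StrictMono (gapPosition I α) := by
  refine strictMono_nat_of_lt_succ fun i => ?_
  rw [gapPosition]
  split_ifs
  · have : ((gapPosition I α i + 1 : ℕ) : ℝ) ≤ ⌈α * ((gapPosition I α i : ℝ) + 1)⌉₊ := by
      refine le_trans ?_ (Nat.le_ceil _)
      push_cast
      exact le_mul_of_one_le_left (by positivity) hα
    exact_mod_cast this
  · exact Nat.lt_succ_self _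

/-- A jump is taken only when the accumulated delay is at most √i, and it leads to at most α(i + √i
+ 1) + 1; the other steps add 1 ≤ α. Hence infinitely many jumps still leave linear growth of slope
α, with a sublinear error. -/
theorem gapPosition_le (I : Set ℕ) {α : ℝ} (hα : 1 ≤ α) (i : ℕ) :
    (gapPosition I α i : ℝ) ≤ α * i + α * √i + 1 := by
  induction i with
  | zero => simp [gapPosition]
  | succ i ih =>
    have hsq : √(i : ℝ) ≤ √((i + 1 : ℕ) : ℝ) := Real.sqrt_le_sqrt (by push_cast; linarith)
    have hs := mul_le_mul_of_nonneg_left hsq (by linarith : 0 ≤ α)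
    rw [gapPosition]
    split_ifs with h
    · have h1 := (Nat.ceil_lt_add_one (a := α * ((gapPosition I α i : ℝ) + 1)) (by positivity)).le
      refine h1.trans ?_
      have hi : i ≤ gapPosition I α i := (gapPosition_strictMono I hα).le_apply
      have h2 : (gapPosition I α i : ℝ) - i ≤ √i := by
        refine Real.le_sqrt_of_sq_le ?_
        have := h.2
        rw [← Nat.cast_sub hi]
        exact_mod_cast this
      have h3 := mul_le_mul_of_nonneg_left h2 (by linarith : 0 ≤ α)
      push_cast at *
      nlinarith
    · push_cast at *
      nlinarith

/-- If jumps stopped, positions would advance one by one and the delay would stay bounded. The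
sparsity condition would then hold at every later element of `I`, which forces a jump. -/
theorem exists_gap {I : Set ℕ} (hI : I.Infinite) {α : ℝ} (hα : 1 ≤ α) (i₀ : ℕ) :
    ∃ i, i₀ ≤ gapPosition I α i ∧ gapPosition I α i + 1 ∈ I ∧
      gapPosition I α (i + 1) = ⌈α * ((gapPosition I α i : ℝ) + 1)⌉₊ := by
  by_contra! hcon
  have hmono := gapPosition_strictMono I hα
  have hstep : ∀ m, gapPosition I α (i₀ + m) = gapPosition I α i₀ + m := by
    intro m
    induction m with
    | zero => rfl
    | succ m ih =>
      have h0 : i₀ + m ≤ gapPosition I α (i₀ + m) := hmono.le_apply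
      have h1 := hcon (i₀ + m) (by omega)
      rw [← add_assoc, gapPosition]
      rw [gapPosition] at h1
      split_ifs with h
      · rw [if_pos h] at h1
        exact absurd rfl (h1 h.1)
      · omega
  have h0 : i₀ ≤ gapPosition I α i₀ := hmono.le_apply
  set W := gapPosition I α i₀
  obtain ⟨n, hn, hlt⟩ := hI.exists_gt (W + W ^ 2 + i₀ + 1)
  obtain ⟨m, rfl⟩ : ∃ m, n = W + m + 1 := ⟨n - W - 1, by omega⟩
  have h1 := hcon (i₀ + m) (by rw [hstep]; omega)
  rw [hstep] at h1
  have h2 := h1 hn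
  rw [gapPosition, hstep, if_pos] at h2
  · exact h2 rfl
  · refine ⟨hn, ?_⟩
    have h3 : W + m - (i₀ + m) ≤ W := by omega
    calc (W + m - (i₀ + m)) ^ 2 ≤ W ^ 2 := Nat.pow_le_pow_left h3 2
      _ ≤ i₀ + m := by omega

/-- For every infinite set `I` of scales there is a map of `[0, 1)` into itself whose values are
all `2 ^ (-α n)`-close to dyadic numbers of order `n` for infinitely many `n ∈ I`, while its inverse
is Hölder of every exponent smaller than `1 / α`. -/
theorem exists_dyadic_approximable_map {I : Set ℕ} (hI : I.Infinite) {α : ℝ} (hα : 1 ≤ α) :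
    ∃ T : ℝ → ℝ, (∀ x ∈ Ico (0 : ℝ) 1, T x ∈ Icc (0 : ℝ) 1) ∧
      (∀ θ > α, ∃ C > 0, ∀ x ∈ Ico (0 : ℝ) 1, ∀ y ∈ Ico (0 : ℝ) 1,
        |x - y| ^ θ ≤ C * |T x - T y|) ∧
      ∀ N : ℕ, ∃ n ∈ I, N ≤ n ∧ ∀ x ∈ Ico (0 : ℝ) 1,
        ∃ j : ℕ, j < 2 ^ n ∧ |T x - j * (1 / 2) ^ n| ≤ (1 / 2 : ℝ) ^ (α * n) := by
  set p := gapPosition I α with hpdef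
  have hp : StrictMono p := gapPosition_strictMono I hα
  refine ⟨spreadDigits p, fun x _ => ⟨?_, ?_⟩, fun θ hθ => ?_, fun N => ?_⟩
  · simpa [spreadDigits] using spreadDigits_tail_nonneg (p := p) x 0
  · have := spreadDigits_tail_le hp x 0
    simpa [spreadDigits, hpdef, gapPosition] using this
  -- Completing the square gives α√m ≤ (θ-α)m + α²/(4(θ-α)); `K` collects this constant and the
  -- index shifts.
  · set K : ℝ := α ^ 2 / (4 * (θ - α)) + θ + 2 with hK
    have hθ0 : 0 < θ - α := sub_pos.2 hθ
    have hpk : ∀ n : ℕ, ((p (n + 1) + 1 : ℕ) : ℝ) ≤ θ * n + K := by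
      intro n
      have h1 := gapPosition_le I hα (n + 1)
      have h2 : α * √((n + 1 : ℕ) : ℝ) ≤ (θ - α) * ((n + 1 : ℕ) : ℝ) + α ^ 2 / (4 * (θ - α)) := by
        have h3 : (√((n + 1 : ℕ) : ℝ)) ^ 2 = ((n + 1 : ℕ) : ℝ) := Real.sq_sqrt (by positivity)
        set q := √((n + 1 : ℕ) : ℝ)
        rw [← h3]
        have h4 : (θ - α) * q ^ 2 + α ^ 2 / (4 * (θ - α)) - α * q =
            ((θ - α) * q - α / 2) ^ 2 / (θ - α) := by
          field_simp
          ring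
        have h5 : 0 ≤ ((θ - α) * q - α / 2) ^ 2 / (θ - α) := by positivity
        linarith
      push_cast at *
      rw [hK]
      linarith
    have key : ∀ x ∈ Ico (0 : ℝ) 1, ∀ y ∈ Ico (0 : ℝ) 1, x < y →
        |x - y| ^ θ ≤ 2 ^ K * |spreadDigits p x - spreadDigits p y| := by
      intro x hx y hy hxy
      rw [abs_sub_comm, abs_of_pos (sub_pos.2 hxy), abs_sub_comm]
      obtain ⟨n, hn1, hn2⟩ := exists_nat_pow_near_of_lt_one (sub_pos.2 hxy)
        (by linarith [hx.1, hy.2]) (by norm_num : (0 : ℝ) < 1 / 2) (by norm_num)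
      have h1 := half_pow_le_spreadDigits_sub hp hx hy (n + 1) hn1
      calc (y - x) ^ θ ≤ (((1 : ℝ) / 2) ^ n) ^ θ :=
            Real.rpow_le_rpow (sub_pos.2 hxy).le hn2 (by linarith)
        _ = 2 ^ K * (1 / 2 : ℝ) ^ (θ * n + K) := by
            rw [← Real.rpow_natCast, ← Real.rpow_mul (by norm_num), Real.rpow_add (by norm_num) (θ * n) K,
              mul_left_comm, ← Real.mul_rpow (by norm_num) (by norm_num), mul_comm θ]
            norm_num
        _ ≤ 2 ^ K * (1 / 2 : ℝ) ^ ((p (n + 1) + 1 : ℕ) : ℝ) :=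
            mul_le_mul_of_nonneg_left (Real.rpow_le_rpow_of_exponent_ge (by norm_num) (by norm_num)
              (hpk n)) (by positivity)
        _ ≤ 2 ^ K * |spreadDigits p y - spreadDigits p x| := by
            rw [Real.rpow_natCast]
            exact mul_le_mul_of_nonneg_left (h1.trans (le_abs_self _)) (by positivity)
    refine ⟨2 ^ K, by positivity, fun x hx y hy => ?_⟩
    rcases lt_trichotomy x y with h | h | h
    · exact key x hx y hy h
    · rw [h, sub_self, abs_zero, Real.zero_rpow (by linarith)]
      positivity
    · rw [abs_sub_comm, abs_sub_comm (spreadDigits p x)]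
      exact key y hy x hx h
  -- Truncating just before the gap gives a dyadic number of order n = p i + 1 ∈ `I`; the next digit
  -- sits only at position ⌈αn⌉.
  · obtain ⟨i, hi, hiI, hgap⟩ := exists_gap hI hα N
    refine ⟨p i + 1, hiI, Nat.le_succ_of_le hi, fun x _ => ?_⟩
    obtain ⟨j, hj, hj'⟩ := exists_dyadic_near_spreadDigits hp x i
    refine ⟨j, hj, hj'.trans ?_⟩
    rw [← Real.rpow_natCast]
    refine Real.rpow_le_rpow_of_exponent_ge (by norm_num) (by norm_num) ?_
    rw [hpdef, hgap]
    push_cast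
    exact Nat.le_ceil _

end BallPoisson

end

/-! ### Central projection from the cube to the sphere -/

noncomputable section

namespace BallPoisson

theorem norm_normalize_sub_normalize_le {E : Type*} [NormedAddCommGroup E] [NormedSpace ℝ E]
    {u v : E} (hu : 1 ≤ ‖u‖) (hv : 1 ≤ ‖v‖) : ‖‖u‖⁻¹ • u - ‖v‖⁻¹ • v‖ ≤ 2 * ‖u - v‖ := by
  have hu0 : (0 : ℝ) < ‖u‖ := by linarith
  have hv0 : (0 : ℝ) < ‖v‖ := by linarith
  have h1 : ‖u‖⁻¹ • u - ‖v‖⁻¹ • v = ‖u‖⁻¹ • (u - v) + (‖u‖⁻¹ - ‖v‖⁻¹) • v := by module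
  have h2 : |‖u‖⁻¹ - ‖v‖⁻¹| * ‖v‖ = ‖u‖⁻¹ * |‖v‖ - ‖u‖| := by
    have : ‖u‖⁻¹ - ‖v‖⁻¹ = ‖u‖⁻¹ * (‖v‖ - ‖u‖) * ‖v‖⁻¹ := by field_simp
    rw [this, abs_mul, abs_mul, abs_of_pos (inv_pos.2 hu0), abs_of_pos (inv_pos.2 hv0)]
    field_simp
  have h3 : |‖v‖ - ‖u‖| ≤ ‖u - v‖ := by
    rw [norm_sub_rev]; exact abs_norm_sub_norm_le v u
  have h4 : ‖u‖⁻¹ ≤ 1 := inv_le_one_of_one_le₀ hu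
  rw [h1]
  refine (norm_add_le _ _).trans ?_
  rw [norm_smul, norm_smul, Real.norm_eq_abs, Real.norm_eq_abs, h2, abs_of_pos (inv_pos.2 hu0)]
  nlinarith [norm_nonneg (u - v), inv_pos.2 hu0, abs_nonneg (‖v‖ - ‖u‖)]

theorem norm_le_of_abs_apply_le {n : ℕ} (v : EuclideanSpace ℝ (Fin n)) {M : ℝ} (hM : 0 ≤ M)
    (h : ∀ i, |v i| ≤ M) : ‖v‖ ≤ n * M := by
  have h1 : ‖v‖ ^ 2 ≤ n * M ^ 2 := by
    rw [EuclideanSpace.norm_sq_eq]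
    calc ∑ i, ‖v i‖ ^ 2 ≤ ∑ _i : Fin n, M ^ 2 :=
          Finset.sum_le_sum fun i _ => pow_le_pow_left₀ (norm_nonneg _) (h i) 2
      _ = _ := by simp
  rcases Nat.eq_zero_or_pos n with hn | hn
  · subst hn
    simp at h1
    simp [h1]
  · have hn' : (1 : ℝ) ≤ n := by exact_mod_cast hn
    refine abs_le_of_sq_le_sq' ?_ (by positivity) |>.2
    nlinarith [sq_nonneg M]

/-- The affine hyperplane of points of first coordinate one. -/
def homogenize {d : ℕ} (x : Fin d → ℝ) : EuclideanSpace ℝ (Fin (d + 1)) :=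
  WithLp.toLp 2 (Fin.cons 1 x)

variable {d : ℕ}

@[simp] theorem homogenize_zero (x : Fin d → ℝ) : homogenize x 0 = 1 := rfl

@[simp] theorem homogenize_succ (x : Fin d → ℝ) (i : Fin d) : homogenize x i.succ = x i := rfl

theorem one_le_norm_homogenize (x : Fin d → ℝ) : 1 ≤ ‖homogenize x‖ := by
  have := PiLp.norm_apply_le (homogenize x) 0
  simpa using this

theorem norm_homogenize_sub_le (x y : Fin d → ℝ) :
    ‖homogenize x - homogenize y‖ ≤ (d + 1) * ‖x - y‖ := by
  have := norm_le_of_abs_apply_le (homogenize x - homogenize y) (norm_nonneg (x - y)) (fun i => by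
    refine Fin.cases ?_ (fun i => ?_) i
    · simp
    · simpa using norm_le_pi_norm (x - y) i)
  exact_mod_cast this

theorem norm_homogenize_le {x : Fin d → ℝ} (hx : ∀ i, x i ∈ Icc (0 : ℝ) 1) :
    ‖homogenize x‖ ≤ d + 1 := by
  have := norm_le_of_abs_apply_le (homogenize x) zero_le_one (fun i => by
    refine Fin.cases ?_ (fun i => ?_) i
    · simp
    · rw [homogenize_succ, abs_of_nonneg (hx i).1]
      exact (hx i).2)
  simpa using this

/-- The central projection of `ℝ^d`, seen as an affine hyperplane of `ℝ^(d+1)`, to the sphere. -/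
def gnomonic (x : Fin d → ℝ) : Sphere d :=
  ⟨‖homogenize x‖⁻¹ • homogenize x, by
    have : ‖homogenize x‖ ≠ 0 := by linarith [one_le_norm_homogenize x]
    rw [mem_sphere_zero_iff_norm, norm_smul, norm_inv, norm_norm, inv_mul_cancel₀ this]⟩

theorem dist_gnomonic_le (x y : Fin d → ℝ) :
    dist (gnomonic x) (gnomonic y) ≤ 2 * (d + 1) * dist x y := by
  rw [Subtype.dist_eq, dist_eq_norm, dist_eq_norm]
  refine (norm_normalize_sub_normalize_le (one_le_norm_homogenize x)
    (one_le_norm_homogenize y)).trans ?_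
  linarith [norm_homogenize_sub_le x y]

theorem continuous_gnomonic : Continuous (gnomonic (d := d)) :=
  (LipschitzWith.of_dist_le_mul (K := (2 * (d + 1) : NNReal)) (by
    simpa using dist_gnomonic_le)).continuous

/-- The first coordinate of the normalized vector is the inverse of its norm, so closeness on the
sphere controls both the norms and the rescaled coordinates. With the Lipschitz bound this makes the
chart bi-Lipschitz on the cube, harmless for dimensions. -/
theorem dist_le_dist_gnomonic {x y : Fin d → ℝ} (hx : ∀ i, x i ∈ Icc (0 : ℝ) 1)
    (hy : ∀ i, y i ∈ Icc (0 : ℝ) 1) :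
    dist x y ≤ 2 * (d + 1) ^ 2 * dist (gnomonic x) (gnomonic y) := by
  set D := dist (gnomonic x) (gnomonic y) with hD
  refine (dist_pi_le_iff (by positivity)).2 fun i => ?_
  set s := ‖homogenize x‖
  set t := ‖homogenize y‖
  have hs1 : 1 ≤ s := one_le_norm_homogenize x
  have ht1 : 1 ≤ t := one_le_norm_homogenize y
  have hs2 : s ≤ d + 1 := norm_homogenize_le hx
  have ht2 : t ≤ d + 1 := norm_homogenize_le hy
  have hcoord : ∀ k, |s⁻¹ * homogenize x k - t⁻¹ * homogenize y k| ≤ D := by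
    intro k
    rw [hD, Subtype.dist_eq, dist_eq_norm]
    exact PiLp.norm_apply_le
      ((gnomonic x : EuclideanSpace ℝ (Fin (d + 1))) - (gnomonic y : EuclideanSpace ℝ (Fin (d + 1)))) k
  have h0 := hcoord 0
  have hi := hcoord i.succ
  simp only [homogenize_zero, homogenize_succ, mul_one] at h0 hi
  have hyi := hy i
  have hid : x i - y i = s * ((s⁻¹ * x i - t⁻¹ * y i) - y i * (s⁻¹ - t⁻¹)) := by
    field_simp
    ring
  rw [Real.dist_eq, hid, abs_mul, abs_of_pos (by linarith)]
  have h1 : |(s⁻¹ * x i - t⁻¹ * y i) - y i * (s⁻¹ - t⁻¹)| ≤ 2 * D := by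
    refine (abs_sub _ _).trans ?_
    rw [abs_mul, abs_of_nonneg hyi.1]
    nlinarith [abs_nonneg (s⁻¹ - t⁻¹), hyi.1, hyi.2]
  have hD0 : 0 ≤ D := dist_nonneg
  calc s * |(s⁻¹ * x i - t⁻¹ * y i) - y i * (s⁻¹ - t⁻¹)| ≤ (d + 1) * (2 * D) := by gcongr
    _ ≤ 2 * (d + 1) ^ 2 * D := by nlinarith [mul_nonneg (Nat.cast_nonneg (α := ℝ) d) hD0]

/-! ### Elementary properties of Poisson integrals -/

variable {𝕜 : Type*} [RCLike 𝕜]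

theorem poissonKernel_nonneg {x : EuclideanSpace ℝ (Fin (d + 1))} (hx : ‖x‖ ≤ 1) (ξ : Sphere d) :
    0 ≤ poissonKernel d x ξ :=
  div_nonneg (by nlinarith [norm_nonneg x]) (by positivity)

theorem poissonKernel_le {x : EuclideanSpace ℝ (Fin (d + 1))} {δ : ℝ} (hδ : 0 < δ)
    (hx : ‖x‖ ≤ 1 - δ) (ξ : Sphere d) : poissonKernel d x ξ ≤ (δ ^ (d + 1))⁻¹ := by
  have hξ : ‖(ξ : EuclideanSpace ℝ (Fin (d + 1)))‖ = 1 := by simp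
  have h1 : δ ≤ ‖x - ξ‖ := by
    have := norm_sub_norm_le (ξ : EuclideanSpace ℝ (Fin (d + 1))) x
    rw [norm_sub_rev] at this
    linarith
  rw [poissonKernel, ← one_div]
  gcongr
  nlinarith [norm_nonneg x]

theorem measurable_poissonKernel (x : EuclideanSpace ℝ (Fin (d + 1))) :
    Measurable (poissonKernel d x) := by
  unfold poissonKernel
  fun_prop

theorem integrable_poissonKernel_smul (f : Lp 𝕜 1 (surfaceMeasure d))
    {x : EuclideanSpace ℝ (Fin (d + 1))} (hx : ‖x‖ < 1) :
    Integrable (fun ξ => poissonKernel d x ξ • f ξ) (surfaceMeasure d) := by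
  refine (L1.integrable_coeFn f).bdd_smul ((1 - ‖x‖) ^ (d + 1))⁻¹
    (measurable_poissonKernel x).aestronglyMeasurable ?_
  refine Eventually.of_forall fun ξ => ?_
  rw [Real.norm_eq_abs, abs_of_nonneg (poissonKernel_nonneg hx.le ξ)]
  exact poissonKernel_le (sub_pos.2 hx) (by linarith) ξ

theorem poissonIntegral_add (f g : Lp 𝕜 1 (surfaceMeasure d))
    {x : EuclideanSpace ℝ (Fin (d + 1))} (hx : ‖x‖ < 1) :
    poissonIntegral d (f + g) x = poissonIntegral d f x + poissonIntegral d g x := by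
  rw [poissonIntegral, poissonIntegral, poissonIntegral,
    ← integral_add (integrable_poissonKernel_smul f hx) (integrable_poissonKernel_smul g hx)]
  refine integral_congr_ae ?_
  filter_upwards [Lp.coeFn_add f g] with ξ hξ
  rw [hξ, Pi.add_apply, smul_add]

theorem poissonIntegral_sub (f g : Lp 𝕜 1 (surfaceMeasure d))
    {x : EuclideanSpace ℝ (Fin (d + 1))} (hx : ‖x‖ < 1) :
    poissonIntegral d (f - g) x = poissonIntegral d f x - poissonIntegral d g x := by
  have := poissonIntegral_add (f - g) g hx
  rw [sub_add_cancel] at this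
  rw [this, add_sub_cancel_right]

theorem poissonIntegral_smul (c : 𝕜) (f : Lp 𝕜 1 (surfaceMeasure d))
    (x : EuclideanSpace ℝ (Fin (d + 1))) :
    poissonIntegral d (c • f) x = c * poissonIntegral d f x := by
  rw [poissonIntegral, poissonIntegral, ← smul_eq_mul, ← integral_smul]
  refine integral_congr_ae ?_
  filter_upwards [Lp.coeFn_smul c f] with ξ hξ
  rw [hξ, Pi.smul_apply, smul_comm]

theorem poissonIntegral_sum {ι : Type*} (s : Finset ι) (f : ι → Lp 𝕜 1 (surfaceMeasure d))
    {x : EuclideanSpace ℝ (Fin (d + 1))} (hx : ‖x‖ < 1) :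
    poissonIntegral d (∑ i ∈ s, f i) x = ∑ i ∈ s, poissonIntegral d (f i) x := by
  classical
  induction s using Finset.induction_on with
  | empty =>
    have := poissonIntegral_smul (0 : 𝕜) (0 : Lp 𝕜 1 (surfaceMeasure d)) x
    simpa using this
  | insert a s ha ih => rw [Finset.sum_insert ha, Finset.sum_insert ha, poissonIntegral_add _ _ hx, ih]

theorem norm_poissonIntegral_le_integral (f : Lp 𝕜 1 (surfaceMeasure d))
    {x : EuclideanSpace ℝ (Fin (d + 1))} (hx : ‖x‖ < 1) :
    ‖poissonIntegral d f x‖ ≤ ∫ ξ, poissonKernel d x ξ * ‖f ξ‖ ∂surfaceMeasure d := by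
  refine (norm_integral_le_integral_norm _).trans (le_of_eq ?_)
  congr 1
  ext ξ
  rw [norm_smul, Real.norm_eq_abs, abs_of_nonneg (poissonKernel_nonneg hx.le ξ)]

/-- A crude bound used for stability: an L¹ error of size ε δ^(d+1) changes the Poisson integral by
at most ε at distance δ from the sphere. -/
theorem norm_poissonIntegral_le (f : Lp 𝕜 1 (surfaceMeasure d))
    {x : EuclideanSpace ℝ (Fin (d + 1))} {δ : ℝ} (hδ : 0 < δ) (hx : ‖x‖ ≤ 1 - δ) :
    ‖poissonIntegral d f x‖ ≤ (δ ^ (d + 1))⁻¹ * ‖f‖ := by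
  refine (norm_poissonIntegral_le_integral f (by linarith)).trans ?_
  rw [L1.norm_eq_integral_norm, ← integral_const_mul]
  refine integral_mono_of_nonneg ?_ ((L1.integrable_coeFn f).norm.const_mul _) ?_
  · exact Eventually.of_forall fun ξ =>
      mul_nonneg (poissonKernel_nonneg (by linarith) ξ) (norm_nonneg _)
  · exact Eventually.of_forall fun ξ =>
      mul_le_mul_of_nonneg_right (poissonKernel_le hδ hx ξ) (norm_nonneg _)

theorem norm_smul_sphere (y : Sphere d) {r : ℝ} (hr : 0 ≤ r) :
    ‖r • (y : EuclideanSpace ℝ (Fin (d + 1)))‖ = r := by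
  rw [norm_smul, Real.norm_eq_abs, abs_of_nonneg hr]
  simp

end BallPoisson

end

/-! ### Growth exponents and the upper bound -/

noncomputable section

namespace BallPoisson

variable {𝕜 : Type*} [RCLike 𝕜] {d : ℕ}

/-- The Poisson kernel at the point `(1 - δ) y` is at most `δ ^ (-d) 2 ^ (-j (d + 1))` on the
`j`-th dyadic annulus around `y`, up to a constant. -/
theorem exists_poissonKernel_le (y ξ : Sphere d) {δ : ℝ} (hδ : 0 < δ) (hδ1 : δ ≤ 1) {J : ℕ}
    (hJ : 2 ≤ 2 ^ J * δ) :
    ∃ j ≤ J, ξ ∈ Metric.closedBall y (2 ^ j * δ) ∧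
      poissonKernel d ((1 - δ) • (y : EuclideanSpace ℝ (Fin (d + 1)))) ξ ≤
        2 * 4 ^ (d + 1) * ((2 ^ j) ^ (d + 1))⁻¹ * (δ ^ d)⁻¹ := by
  classical
  have hex : ∃ j : ℕ, dist ξ y ≤ 2 ^ j * δ := by
    refine ⟨J, le_trans ?_ hJ⟩
    rw [Subtype.dist_eq, dist_eq_norm]
    refine (norm_sub_le _ _).trans ?_
    simp
    norm_num
  have hyn : ‖(y : EuclideanSpace ℝ (Fin (d + 1)))‖ = 1 := by simp
  have hξn : ‖(ξ : EuclideanSpace ℝ (Fin (d + 1)))‖ = 1 := by simp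
  set x := (1 - δ) • (y : EuclideanSpace ℝ (Fin (d + 1))) with hx
  have hxn : ‖x‖ = 1 - δ := norm_smul_sphere y (by linarith)
  have hfar : δ ≤ ‖x - ξ‖ := by
    have := norm_sub_norm_le (ξ : EuclideanSpace ℝ (Fin (d + 1))) x
    rw [norm_sub_rev] at this
    linarith
  have hdist : dist ξ y ≤ 2 * ‖x - ξ‖ := by
    rw [Subtype.dist_eq, dist_eq_norm]
    have h1 : (ξ : EuclideanSpace ℝ (Fin (d + 1))) - y = -(x - ξ) + (-δ) • (y : EuclideanSpace ℝ (Fin (d + 1))) := by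
      rw [hx]; module
    rw [h1]
    refine (norm_add_le _ _).trans ?_
    rw [norm_neg, norm_smul, hyn, norm_neg, Real.norm_eq_abs, abs_of_pos hδ]
    linarith
  have hnum : 1 - ‖x‖ ^ 2 ≤ 2 * δ := by rw [hxn]; nlinarith
  refine ⟨Nat.find hex, ?_, Nat.find_spec hex, ?_⟩
  · refine Nat.find_min' hex (le_trans ?_ hJ)
    rw [Subtype.dist_eq, dist_eq_norm]
    refine (norm_sub_le _ _).trans ?_
    simp
    norm_num
  -- Minimality of `j` puts `ξ` farther than 2^(j-1) δ from `y`, and half of that separates it from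
  -- the interior point; for j = 0 the depth δ itself is enough.
  · set j := Nat.find hex with hj
    have hlow : 2 ^ j * δ / 4 ≤ ‖x - ξ‖ := by
      rcases Nat.eq_zero_or_pos j with h0 | h0
      · rw [h0]; linarith
      · have h1 := Nat.find_min hex (m := j - 1) (by omega)
        push Not at h1
        have h2 : (2 : ℝ) ^ j = 2 * 2 ^ (j - 1) := by
          rw [← pow_succ']; congr 1; omega
        rw [h2]
        linarith
    calc poissonKernel d x ξ ≤ (2 * δ) / (2 ^ j * δ / 4) ^ (d + 1) := by
          rw [poissonKernel]
          gcongr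
      _ = _ := by
          rw [div_pow, mul_pow, pow_succ δ]
          field_simp

/-- A power bound for the mass of `|f|` in the balls centred at `y` gives a power bound for the
Poisson integral of `f` on the radius ending at `y`. -/
theorem exists_norm_poissonIntegral_le (d : ℕ) {γ : ℝ} (hγ : -1 < γ) :
    ∃ C > 0, ∀ (f : Lp 𝕜 1 (surfaceMeasure d)) (y : Sphere d) (A : ℝ), 0 ≤ A →
      (∀ ρ > 0, ∫ ξ in Metric.closedBall y ρ, ‖f ξ‖ ∂surfaceMeasure d ≤ A * ρ ^ (d - γ)) →
      ∀ δ, 0 < δ → δ ≤ 1 →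
        ‖poissonIntegral d f ((1 - δ) • (y : EuclideanSpace ℝ (Fin (d + 1))))‖ ≤
          C * A * δ ^ (-γ) := by
  -- The j-th annulus contributes 2^(-j(d+1)) · 2^(j(d-γ)) = q^j; convergence is exactly the
  -- condition γ > -1.
  set q : ℝ := (2 : ℝ) ^ (-(1 + γ)) with hq
  have hq0 : 0 < q := by positivity
  have hq1 : q < 1 := Real.rpow_lt_one_of_one_lt_of_neg (by norm_num) (by linarith)
  refine ⟨2 * 4 ^ (d + 1) * (1 - q)⁻¹, by have := sub_pos.2 hq1; positivity, ?_⟩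
  intro f y A hA hf δ hδ hδ1
  obtain ⟨J, hJ⟩ : ∃ J : ℕ, 2 / δ < 2 ^ J := pow_unbounded_of_one_lt _ (by norm_num)
  have hJ' : 2 ≤ 2 ^ J * δ := by
    rw [div_lt_iff₀ hδ] at hJ; exact hJ.le
  set x := (1 - δ) • (y : EuclideanSpace ℝ (Fin (d + 1))) with hx
  have hxn : ‖x‖ = 1 - δ := norm_smul_sphere y (by linarith)
  set c : ℕ → ℝ := fun j => 2 * 4 ^ (d + 1) * ((2 ^ j) ^ (d + 1))⁻¹ * (δ ^ d)⁻¹ with hc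
  have hc0 : ∀ j, 0 ≤ c j := fun j => by positivity
  have hfi := (L1.integrable_coeFn f).norm
  have hint : ∀ j, Integrable (fun ξ => c j *
      (Metric.closedBall y (2 ^ j * δ)).indicator (fun ξ => ‖f ξ‖) ξ) (surfaceMeasure d) :=
    fun j => (hfi.indicator Metric.isClosed_closedBall.measurableSet).const_mul _
  calc ‖poissonIntegral d f x‖ ≤ ∫ ξ, poissonKernel d x ξ * ‖f ξ‖ ∂surfaceMeasure d :=
        norm_poissonIntegral_le_integral f (by linarith)
    _ ≤ ∫ ξ, ∑ j ∈ Finset.range (J + 1), c j *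
          (Metric.closedBall y (2 ^ j * δ)).indicator (fun ξ => ‖f ξ‖) ξ ∂surfaceMeasure d := by
        refine integral_mono_of_nonneg ?_ (integrable_finsetSum _ fun j _ => hint j) ?_
        · exact Eventually.of_forall fun ξ =>
            mul_nonneg (poissonKernel_nonneg (by linarith) ξ) (norm_nonneg _)
        · refine Eventually.of_forall fun ξ => ?_
          obtain ⟨j, hj, hmem, hle⟩ := exists_poissonKernel_le y ξ hδ hδ1 hJ'
          refine le_trans ?_ (Finset.single_le_sum (f := fun j => c j *
            (Metric.closedBall y (2 ^ j * δ)).indicator (fun ξ => ‖f ξ‖) ξ) (fun i _ => ?_)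
            (Finset.mem_range.2 (Nat.lt_succ_of_le hj)))
          · simp only [indicator_of_mem hmem]
            exact mul_le_mul_of_nonneg_right hle (norm_nonneg _)
          · exact mul_nonneg (hc0 i) (indicator_nonneg (fun _ _ => norm_nonneg _) _)
    _ = ∑ j ∈ Finset.range (J + 1), c j *
          ∫ ξ in Metric.closedBall y (2 ^ j * δ), ‖f ξ‖ ∂surfaceMeasure d := by
        rw [integral_finsetSum _ fun j _ => hint j]
        refine Finset.sum_congr rfl fun j _ => ?_
        rw [integral_const_mul, integral_indicator Metric.isClosed_closedBall.measurableSet]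
    _ ≤ ∑ j ∈ Finset.range (J + 1), 2 * 4 ^ (d + 1) * A * δ ^ (-γ) * q ^ j := by
        refine Finset.sum_le_sum fun j _ => ?_
        refine (mul_le_mul_of_nonneg_left (hf _ (by positivity)) (hc0 j)).trans (le_of_eq ?_)
        have h1 : q ^ j = ((2 ^ j) ^ (d + 1))⁻¹ * ((2 : ℝ) ^ j) ^ (d - γ) := by
          rw [hq, ← Real.rpow_natCast, ← Real.rpow_mul (by norm_num), ← Real.rpow_natCast 2 j,
            ← Real.rpow_natCast _ (d + 1), ← Real.rpow_mul (by norm_num),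
            ← Real.rpow_mul (by norm_num), ← Real.rpow_neg (by norm_num),
            ← Real.rpow_add (by norm_num)]
          congr 1
          push_cast
          ring
        have h2 : δ ^ (-γ) = (δ ^ d)⁻¹ * δ ^ (d - γ) := by
          rw [← Real.rpow_natCast δ d, ← Real.rpow_neg hδ.le, ← Real.rpow_add hδ]
          congr 1
          ring
        rw [h1, h2, Real.mul_rpow (by positivity) hδ.le, hc]
        ring
    _ = 2 * 4 ^ (d + 1) * A * δ ^ (-γ) * ∑ j ∈ Finset.range (J + 1), q ^ j := by
        rw [Finset.mul_sum]
    _ ≤ 2 * 4 ^ (d + 1) * A * δ ^ (-γ) * (1 - q)⁻¹ := by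
        gcongr
        rw [← tsum_geometric_of_lt_one hq0.le hq1]
        exact (summable_geometric_of_lt_one hq0.le hq1).sum_le_tsum _ fun _ _ => by positivity
    _ = _ := by ring

/-- Poisson integrals of continuous functions are bounded. -/
theorem exists_norm_poissonIntegral_toLp_le (g : C(Sphere d, 𝕜)) :
    ∃ M : ℝ, ∀ (y : Sphere d) (δ : ℝ), 0 < δ → δ ≤ 1 →
      ‖poissonIntegral d (ContinuousMap.toLp 1 (surfaceMeasure d) 𝕜 g)
        ((1 - δ) • (y : EuclideanSpace ℝ (Fin (d + 1))))‖ ≤ M := by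
  obtain ⟨A, hA, hball⟩ := exists_surfaceMeasure_closedBall_le d
  obtain ⟨C, hC, hbound⟩ := exists_norm_poissonIntegral_le (𝕜 := 𝕜) d (γ := 0) (by norm_num)
  refine ⟨C * (‖g‖ * A), fun y δ hδ hδ1 => ?_⟩
  have := hbound (ContinuousMap.toLp 1 (surfaceMeasure d) 𝕜 g) y (‖g‖ * A) (by positivity) ?_ δ hδ hδ1
  · simpa using this
  · intro ρ hρ
    calc ∫ ξ in Metric.closedBall y ρ, ‖ContinuousMap.toLp 1 (surfaceMeasure d) 𝕜 g ξ‖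
          ∂surfaceMeasure d ≤ ∫ ξ in Metric.closedBall y ρ, ‖g‖ ∂surfaceMeasure d := by
          refine setIntegral_mono_ae (L1.integrable_coeFn _).norm.integrableOn
            (integrable_const _).integrableOn ?_
          filter_upwards [ContinuousMap.coeFn_toLp (p := 1) (𝕜 := 𝕜) (surfaceMeasure d) g] with ξ hξ
          rw [hξ]
          exact g.norm_coe_le_norm ξ
      _ = (surfaceMeasure d).real (Metric.closedBall y ρ) * ‖g‖ := by
          rw [setIntegral_const, smul_eq_mul]
      _ ≤ A * ρ ^ d * ‖g‖ := by gcongr; exact hball y ρ hρ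
      _ = ‖g‖ * A * ρ ^ ((d : ℝ) - 0) := by rw [sub_zero, Real.rpow_natCast]; ring

theorem log_enorm_div_le_iff {E : Type*} [NormedAddCommGroup E] (z : E) {δ : ℝ} (hδ : 0 < δ)
    (hδ1 : δ < 1) (γ : ℝ) :
    ENNReal.log ‖z‖ₑ / ((-Real.log δ : ℝ) : EReal) ≤ γ ↔ ‖z‖ ≤ δ ^ (-γ) := by
  have hlog : 0 < -Real.log δ := by linarith [Real.log_neg hδ hδ1]
  have h1 : ((-Real.log δ : ℝ) : EReal) * γ = ENNReal.log (ENNReal.ofReal (δ ^ (-γ))) := by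
    rw [ENNReal.log_ofReal_of_pos (by positivity), Real.log_rpow hδ, ← EReal.coe_mul]
    congr 1
    ring
  rw [EReal.div_le_iff_le_mul (by exact_mod_cast hlog) (EReal.coe_ne_top _), h1,
    ENNReal.log_le_log_iff, ← ofReal_norm, ENNReal.ofReal_le_ofReal_iff (by positivity)]

theorem le_log_enorm_div_iff {E : Type*} [NormedAddCommGroup E] (z : E) {δ : ℝ} (hδ : 0 < δ)
    (hδ1 : δ < 1) (γ : ℝ) :
    γ ≤ ENNReal.log ‖z‖ₑ / ((-Real.log δ : ℝ) : EReal) ↔ δ ^ (-γ) ≤ ‖z‖ := by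
  have hlog : 0 < -Real.log δ := by linarith [Real.log_neg hδ hδ1]
  have h1 : γ * ((-Real.log δ : ℝ) : EReal) = ENNReal.log (ENNReal.ofReal (δ ^ (-γ))) := by
    rw [ENNReal.log_ofReal_of_pos (by positivity), Real.log_rpow hδ, ← EReal.coe_mul]
    congr 1
    ring
  rw [EReal.le_div_iff_mul_le (by exact_mod_cast hlog) (EReal.coe_ne_top _), h1,
    ENNReal.log_le_log_iff, ← ofReal_norm, ENNReal.ofReal_le_ofReal_iff (norm_nonneg _)]

/-- Any γ' > γ absorbs the constant, since A(1-r)^(γ'-γ) tends to 0. -/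
theorem growthExponent_le_of_forall_le {f : Lp 𝕜 1 (surfaceMeasure d)} {y : Sphere d} {γ A : ℝ}
    (h : ∀ δ, 0 < δ → δ ≤ 1 →
      ‖poissonIntegral d f ((1 - δ) • (y : EuclideanSpace ℝ (Fin (d + 1))))‖ ≤ A * δ ^ (-γ)) :
    growthExponent d f y ≤ γ := by
  refine EReal.le_of_forall_lt_iff_le.1 fun γ' hγ' => ?_
  have hγ'' : 0 < γ' - γ := sub_pos.2 (by exact_mod_cast hγ')
  refine limsup_le_of_le (by isBoundedDefault) ?_
  have hlim : Tendsto (fun r : ℝ => A * (1 - r) ^ (γ' - γ)) (𝓝[<] 1) (𝓝 0) := by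
    have h1 : Continuous fun r : ℝ => A * (1 - r) ^ (γ' - γ) :=
      continuous_const.mul ((continuous_const.sub continuous_id).rpow_const fun _ => Or.inr hγ''.le)
    have h2 := h1.tendsto 1
    simp only [sub_self, Real.zero_rpow hγ''.ne', mul_zero] at h2
    exact h2.mono_left nhdsWithin_le_nhds
  filter_upwards [hlim.eventually (gt_mem_nhds zero_lt_one), Ioo_mem_nhdsLT (zero_lt_one' ℝ)]
    with r hr ⟨hr0, hr1⟩
  rw [log_enorm_div_le_iff _ (by linarith) (by linarith)]
  have h1 := h (1 - r) (by linarith) (by linarith)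
  rw [sub_sub_cancel] at h1
  refine h1.trans ?_
  have h2 : (1 - r) ^ (-γ) = (1 - r) ^ (γ' - γ) * (1 - r) ^ (-γ') := by
    rw [← Real.rpow_add (by linarith)]
    congr 1
    ring
  rw [h2, ← mul_assoc]
  exact mul_le_of_le_one_left (Real.rpow_nonneg (by linarith) _) hr.le

theorem le_growthExponent_of_forall_exists {f : Lp 𝕜 1 (surfaceMeasure d)} {y : Sphere d} {β : ℝ}
    (h : ∀ β' < β, ∀ δ₀ > 0, ∃ δ, 0 < δ ∧ δ < δ₀ ∧ δ < 1 ∧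
      δ ^ (-β') ≤ ‖poissonIntegral d f ((1 - δ) • (y : EuclideanSpace ℝ (Fin (d + 1))))‖) :
    β ≤ growthExponent d f y := by
  refine EReal.ge_of_forall_gt_iff_ge.1 fun β' hβ' => ?_
  refine le_limsup_of_frequently_le ?_ (by isBoundedDefault)
  rw [frequently_iff]
  intro U hU
  obtain ⟨l, hl, hlU⟩ := (mem_nhdsLT_iff_exists_Ioo_subset' (zero_lt_one' ℝ)).1 hU
  obtain ⟨δ, h0, h1, h2, h3⟩ := h β' (by exact_mod_cast hβ') (1 - l) (by
    have : l < 1 := hl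
    linarith)
  refine ⟨1 - δ, hlU ⟨by linarith, by linarith⟩, ?_⟩
  simp only [sub_sub_cancel]
  rwa [le_log_enorm_div_iff _ h0 h2]

/-- The set where the growth exponent of a Poisson integral exceeds `γ` has dimension at most
`d - γ`. -/
theorem dimH_growthExponent_gt_le (f : Lp 𝕜 1 (surfaceMeasure d)) {γ : ℝ} (hγ : -1 < γ)
    (hγd : γ < d) :
    dimH {y | (γ : EReal) < growthExponent d f y} ≤ ENNReal.ofReal (d - γ) := by
  set ν : Measure (Sphere d) := (surfaceMeasure d).withDensity fun ξ => ‖f ξ‖ₑ with hν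
  have hfi := L1.integrable_coeFn f
  have : IsFiniteMeasure ν := isFiniteMeasure_withDensity hfi.2.ne
  have hνr : ∀ (y : Sphere d) (ρ : ℝ), ν.real (Metric.closedBall y ρ) =
      ∫ ξ in Metric.closedBall y ρ, ‖f ξ‖ ∂surfaceMeasure d := by
    intro y ρ
    rw [measureReal_def, hν, withDensity_apply _ Metric.isClosed_closedBall.measurableSet,
      integral_norm_eq_lintegral_enorm hfi.1.restrict]
  obtain ⟨C, hC, hbound⟩ := exists_norm_poissonIntegral_le (𝕜 := 𝕜) d hγ
  have hs : 0 < (d : ℝ) - γ := sub_pos.2 hγd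
  refine dimH_le_of_frequently_rpow_le_measureReal_closedBall ν hs fun y hy ρ₀ hρ₀ => ?_
  by_contra! hcon
  refine absurd (show (γ : EReal) < growthExponent d f y from hy) (not_lt.2 ?_)
  set m := ν.real univ
  have hm : 0 ≤ m := measureReal_nonneg
  -- The 1 handles radii below ρ₀ and the quotient handles larger radii through the total mass.
  set A := 1 + m / ρ₀ ^ (d - γ) with hA
  refine growthExponent_le_of_forall_le (A := C * A) (hbound f y A (by positivity) ?_)
  intro ρ hρ
  rw [← hνr]
  rcases lt_or_ge ρ ρ₀ with h | h
  · refine (hcon ρ hρ h).le.trans (le_mul_of_one_le_left (by positivity) ?_)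
    rw [hA]
    have : 0 ≤ m / ρ₀ ^ (d - γ) := by positivity
    linarith
  · calc ν.real (Metric.closedBall y ρ) ≤ m := measureReal_mono (subset_univ _)
      _ = m / ρ₀ ^ (d - γ) * ρ₀ ^ (d - γ) := by field_simp
      _ ≤ A * ρ ^ (d - γ) := by
          gcongr
          rw [hA]
          linarith

/-- The thresholds β - 1/(n+2) stay above -1 when β = 0 and below d when β = d, so both endpoints
are covered by the limit. -/
theorem dimH_levelSet_le (f : Lp 𝕜 1 (surfaceMeasure d)) {β : ℝ} (hβ : β ∈ Icc (0 : ℝ) d) :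
    dimH (levelSet d β f) ≤ ENNReal.ofReal (d - β) := by
  have hlim : Tendsto (fun n : ℕ => ENNReal.ofReal (d - (β - 1 / ((n : ℝ) + 2)))) atTop
      (𝓝 (ENNReal.ofReal (d - β))) := by
    refine ENNReal.tendsto_ofReal ?_
    have h1 : Tendsto (fun n : ℕ => 1 / ((n : ℝ) + 2)) atTop (𝓝 0) :=
      tendsto_const_nhds.div_atTop (tendsto_atTop_add_const_right _ _ tendsto_natCast_atTop_atTop)
    simpa using (tendsto_const_nhds (x := β)).sub h1 |>.const_sub (d : ℝ)
  refine ge_of_tendsto' hlim fun n => ?_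
  have h0 : (0 : ℝ) < 1 / ((n : ℝ) + 2) := by positivity
  have h1 : 1 / ((n : ℝ) + 2) < 1 := by
    rw [div_lt_one (by positivity)]
    linarith [Nat.cast_nonneg (α := ℝ) n]
  refine (dimH_mono ?_).trans (dimH_growthExponent_gt_le f (γ := β - 1 / ((n : ℝ) + 2))
    (by linarith [hβ.1]) (by linarith [hβ.2]))
  intro y hy
  rw [mem_ofPred_eq, show growthExponent d f y = β from hy]
  exact_mod_cast sub_lt_self β h0

end BallPoisson

end

/-! ### Combs of bumps and the transfer of dimension -/

noncomputable section

namespace BallPoisson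

variable {𝕜 : Type*} [RCLike 𝕜] {d : ℕ}

variable (𝕜) in
/-- The normalized indicator function of a spherical cap. -/
def capBump (a : Sphere d) (η : ℝ) : Lp 𝕜 1 (surfaceMeasure d) :=
  indicatorConstLp 1 (Metric.isClosed_closedBall (x := a) (ε := η)).measurableSet
    (measure_ne_top _ _) ((((surfaceMeasure d).real (Metric.closedBall a η))⁻¹ : ℝ) : 𝕜)

theorem norm_capBump_le (a : Sphere d) (η : ℝ) : ‖capBump 𝕜 a η‖ ≤ 1 := by
  rw [capBump, norm_indicatorConstLp one_ne_zero ENNReal.one_ne_top, RCLike.norm_ofReal,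
    abs_of_nonneg (inv_nonneg.2 measureReal_nonneg)]
  simp only [ENNReal.toReal_one, div_one, Real.rpow_one]
  exact inv_mul_le_one

/-- The integral is the mean of the kernel over the cap. Being real and nonnegative, such
contributions cannot cancel, so one bump of a comb bounds the whole from below. -/
theorem exists_poissonIntegral_capBump_eq (a : Sphere d) {η : ℝ} (hη : 0 < η)
    {x : EuclideanSpace ℝ (Fin (d + 1))} (hx : ‖x‖ < 1) :
    ∃ t : ℝ, 0 ≤ t ∧ poissonIntegral d (capBump 𝕜 a η) x = t ∧
      ∀ b, (∀ ξ ∈ Metric.closedBall a η, b ≤ poissonKernel d x ξ) → b ≤ t := by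
  set B := Metric.closedBall a η
  set m := (surfaceMeasure d).real B with hm
  have hB : MeasurableSet B := Metric.isClosed_closedBall.measurableSet
  have hm0 : 0 < m :=
    ENNReal.toReal_pos (Metric.measure_closedBall_pos _ _ hη).ne' (measure_ne_top _ _)
  have hKi : Integrable (poissonKernel d x) (surfaceMeasure d) := by
    refine Integrable.of_bound (measurable_poissonKernel x).aestronglyMeasurable
      ((1 - ‖x‖) ^ (d + 1))⁻¹ (Eventually.of_forall fun ξ => ?_)
    rw [Real.norm_eq_abs, abs_of_nonneg (poissonKernel_nonneg hx.le ξ)]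
    exact poissonKernel_le (sub_pos.2 hx) (by linarith) ξ
  refine ⟨m⁻¹ * ∫ ξ in B, poissonKernel d x ξ ∂surfaceMeasure d, ?_, ?_, fun b hb => ?_⟩
  · exact mul_nonneg (inv_nonneg.2 hm0.le)
      (integral_nonneg fun ξ => poissonKernel_nonneg hx.le ξ)
  · rw [← integral_const_mul, ← integral_indicator hB, ← integral_ofReal, poissonIntegral]
    refine integral_congr_ae ?_
    filter_upwards [indicatorConstLp_coeFn (p := 1) (hs := hB) (hμs := measure_ne_top _ _)
      (μ := surfaceMeasure d) (c := ((m⁻¹ : ℝ) : 𝕜))] with ξ hξ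
    change poissonKernel d x ξ • (indicatorConstLp 1 hB (measure_ne_top _ _) ((m⁻¹ : ℝ) : 𝕜)) ξ = _
    rw [hξ]
    by_cases h : ξ ∈ B
    · rw [indicator_of_mem h, indicator_of_mem h, RCLike.real_smul_eq_coe_mul]
      push_cast
      ring
    · rw [indicator_of_notMem h, indicator_of_notMem h]
      simp
  · have h1 : b * m ≤ ∫ ξ in B, poissonKernel d x ξ ∂surfaceMeasure d := by
      have : ∫ _ in B, b ∂surfaceMeasure d = b * m := by
        rw [setIntegral_const, smul_eq_mul, mul_comm]
      rw [← this]
      exact setIntegral_mono_on (integrable_const _).integrableOn hKi.integrableOn hB hb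
    rw [inv_mul_eq_div, le_div_iff₀ hm0]
    exact h1

/-- The dyadic point of order `n` with numerators `j`. -/
def dyadicPoint {n : ℕ} (j : Fin d → Fin (2 ^ n)) : Fin d → ℝ := fun i => (j i : ℝ) * (1 / 2) ^ n

variable (𝕜) in
/-- The average of normalized indicator functions of tiny caps centred at the images of the dyadic
points of order `n`. -/
def dyadicComb (d n : ℕ) : Lp 𝕜 1 (surfaceMeasure d) :=
  ∑ j : Fin d → Fin (2 ^ n), ((((1 : ℝ) / 2) ^ (n * d) : ℝ) : 𝕜) •
    capBump 𝕜 (gnomonic (dyadicPoint j)) ((1 / 2) ^ n ^ 2)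

theorem norm_dyadicComb_le (d n : ℕ) : ‖dyadicComb 𝕜 d n‖ ≤ 1 := by
  refine (norm_sum_le _ _).trans ?_
  calc _ ≤ ∑ _j : Fin d → Fin (2 ^ n), ((1 : ℝ) / 2) ^ (n * d) := by
        refine Finset.sum_le_sum fun j _ => ?_
        rw [norm_smul, RCLike.norm_ofReal, abs_of_pos (by positivity)]
        exact mul_le_of_le_one_right (by positivity) (norm_capBump_le _ _)
    _ = 1 := by
        rw [Finset.sum_const, nsmul_eq_mul, Finset.card_univ, Fintype.card_fun, Fintype.card_fin,
          Fintype.card_fin]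
        push_cast
        rw [← pow_mul, ← mul_pow]
        norm_num

/-- Only the bump at `j` is kept. On its cap the distance to the interior point is at most δ +
2(d+1)δ + δ = (2d+4)δ: depth, Lipschitz bound of the chart, radius of the cap. -/
theorem le_norm_poissonIntegral_dyadicComb {n : ℕ} {x : Fin d → ℝ} (j : Fin d → Fin (2 ^ n))
    {δ : ℝ} (hδ : (1 / 2) ^ n ^ 2 ≤ δ) (hδ1 : δ ≤ 1) (hx : dist x (dyadicPoint j) ≤ δ) :
    ((2 * d + 4 : ℝ) ^ (d + 1))⁻¹ * (1 / 2) ^ (n * d) * (δ ^ d)⁻¹ ≤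
      ‖poissonIntegral d (dyadicComb 𝕜 d n)
        ((1 - δ) • (gnomonic x : EuclideanSpace ℝ (Fin (d + 1))))‖ := by
  have hδ0 : 0 < δ := lt_of_lt_of_le (by positivity) hδ
  set z := (1 - δ) • (gnomonic x : EuclideanSpace ℝ (Fin (d + 1))) with hz
  have hzn : ‖z‖ = 1 - δ := norm_smul_sphere _ (by linarith)
  have hz1 : ‖z‖ < 1 := by linarith
  choose t ht0 ht htb using fun i : Fin d → Fin (2 ^ n) =>
    exists_poissonIntegral_capBump_eq (𝕜 := 𝕜) (gnomonic (dyadicPoint i))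
      (η := (1 / 2) ^ n ^ 2) (by positivity) hz1
  have hsum : poissonIntegral d (dyadicComb 𝕜 d n) z =
      ((∑ i, (1 / 2) ^ (n * d) * t i : ℝ) : 𝕜) := by
    rw [dyadicComb, poissonIntegral_sum _ _ hz1]
    push_cast
    refine Finset.sum_congr rfl fun i _ => ?_
    rw [poissonIntegral_smul, ht i]
  have hker : ∀ ξ ∈ Metric.closedBall (gnomonic (dyadicPoint j)) ((1 / 2) ^ n ^ 2),
      ((2 * d + 4 : ℝ) ^ (d + 1))⁻¹ * (δ ^ d)⁻¹ ≤ poissonKernel d z ξ := by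
    intro ξ hξ
    have hξn : ‖(ξ : EuclideanSpace ℝ (Fin (d + 1)))‖ = 1 := by simp
    have hgn : ‖(gnomonic x : EuclideanSpace ℝ (Fin (d + 1)))‖ = 1 := by simp
    have hfar : δ ≤ ‖z - ξ‖ := by
      have := norm_sub_norm_le (ξ : EuclideanSpace ℝ (Fin (d + 1))) z
      rw [norm_sub_rev] at this
      linarith
    have hnear : ‖z - ξ‖ ≤ (2 * d + 4) * δ := by
      have h1 : z - ξ = (-δ) • (gnomonic x : EuclideanSpace ℝ (Fin (d + 1))) +
          ((gnomonic x : EuclideanSpace ℝ (Fin (d + 1))) - ξ) := by rw [hz]; module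
      have h2 : ‖(gnomonic x : EuclideanSpace ℝ (Fin (d + 1))) - ξ‖ ≤
          2 * (d + 1) * δ + δ := by
        rw [← dist_eq_norm, ← Subtype.dist_eq]
        refine (dist_triangle _ (gnomonic (dyadicPoint j)) _).trans ?_
        rw [Metric.mem_closedBall, dist_comm] at hξ
        refine add_le_add ((dist_gnomonic_le _ _).trans ?_) (hξ.trans hδ)
        gcongr
      rw [h1]
      refine (norm_add_le _ _).trans ?_
      rw [norm_smul, hgn, norm_neg, Real.norm_eq_abs, abs_of_pos hδ0]
      linarith
    calc ((2 * d + 4 : ℝ) ^ (d + 1))⁻¹ * (δ ^ d)⁻¹ = δ / ((2 * d + 4) * δ) ^ (d + 1) := by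
          rw [mul_pow, pow_succ δ]
          field_simp
      _ ≤ poissonKernel d z ξ := by
          rw [poissonKernel]
          have h1 : 0 < ‖z - ξ‖ := by linarith
          have h2 : δ ≤ 1 - ‖z‖ ^ 2 := by rw [hzn]; nlinarith
          gcongr
          exact hδ0.le.trans h2
  rw [hsum, RCLike.norm_ofReal]
  refine le_trans ?_ (le_abs_self _)
  calc ((2 * d + 4 : ℝ) ^ (d + 1))⁻¹ * (1 / 2) ^ (n * d) * (δ ^ d)⁻¹
      = (1 / 2) ^ (n * d) * (((2 * d + 4 : ℝ) ^ (d + 1))⁻¹ * (δ ^ d)⁻¹) := by ring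
    _ ≤ (1 / 2) ^ (n * d) * t j := mul_le_mul_of_nonneg_left (htb j _ hker) (by positivity)
    _ ≤ _ := Finset.single_le_sum (f := fun i => (1 / 2) ^ (n * d) * t i)
        (fun i _ => mul_nonneg (by positivity) (ht0 i)) (Finset.mem_univ j)

/-- A map with Hölder inverse increases the dimension at least by the inverse exponent. -/
theorem dimH_le_mul_dimH_image {X Y : Type*} [MetricSpace X] [MetricSpace Y] {Φ : X → Y}
    {S : Set X} {θ C : ℝ} (hθ : 0 < θ) (hC : 0 < C)
    (h : ∀ x ∈ S, ∀ y ∈ S, dist x y ^ θ ≤ C * dist (Φ x) (Φ y)) :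
    dimH S ≤ ENNReal.ofReal θ * dimH (Φ '' S) := by
  rcases S.eq_empty_or_nonempty with rfl | ⟨x₀, hx₀⟩
  · simp
  have hne : Nonempty X := ⟨x₀⟩
  have hinj : InjOn Φ S := by
    intro x hx y hy hxy
    have h1 := h x hx y hy
    rw [hxy, dist_self, mul_zero] at h1
    by_contra hne
    exact absurd (Real.rpow_pos_of_pos (dist_pos.2 hne) θ) (not_lt.2 h1)
  set g := Function.invFunOn Φ S
  have hg : ∀ x ∈ S, g (Φ x) = x := fun x hx => hinj.leftInvOn_invFunOn hx
  have himg : g '' (Φ '' S) = S := by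
    rw [image_image]
    exact (image_congr hg).trans (image_id' S)
  have hhol : HolderOnWith (C ^ (θ⁻¹)).toNNReal (θ⁻¹).toNNReal g (Φ '' S) := by
    rintro _ ⟨x, hx, rfl⟩ _ ⟨y, hy, rfl⟩
    rw [hg x hx, hg y hy, Real.coe_toNNReal _ (inv_nonneg.2 hθ.le), edist_dist, edist_dist,
      ENNReal.ofReal_rpow_of_nonneg dist_nonneg (inv_nonneg.2 hθ.le)]
    change _ ≤ ENNReal.ofReal _ * _
    rw [← ENNReal.ofReal_mul (by positivity), ← Real.mul_rpow hC.le dist_nonneg]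
    refine ENNReal.ofReal_le_ofReal ?_
    calc dist x y = (dist x y ^ θ) ^ θ⁻¹ := (Real.rpow_rpow_inv dist_nonneg hθ.ne').symm
      _ ≤ _ := Real.rpow_le_rpow (by positivity) (h x hx y hy) (by positivity)
  have := hhol.dimH_image_le (Real.toNNReal_pos.2 (inv_pos.2 hθ))
  rw [himg] at this
  refine this.trans (le_of_eq ?_)
  rw [ENNReal.div_eq_inv_mul]
  congr 1
  change (ENNReal.ofReal θ⁻¹)⁻¹ = _
  rw [ENNReal.ofReal_inv_of_pos hθ, inv_inv]

theorem le_dimH_of_volume_ne_zero {S : Set (Fin d → ℝ)} (h : volume S ≠ 0) :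
    (d : ENNReal) ≤ dimH S := by
  rw [← hausdorffMeasure_pi_real] at h
  have := le_dimH_of_hausdorffMeasure_ne_zero (d := (d : NNReal)) (s := S) (by simpa using h)
  simpa using this

/-- If a set of positive Lebesgue measure in `ℝ^d` is mapped to points of growth exponent at least
`β` by a map whose inverse is Hölder of every exponent smaller than `1 - β / d`, then `E(β, f)` has
dimension at least `d - β`. -/
theorem le_dimH_levelSet (hd : 1 ≤ d) {β : ℝ} (hβd : β < d) (hβ : 0 ≤ β)
    (f : Lp 𝕜 1 (surfaceMeasure d)) {Y : Set (Fin d → ℝ)} (hY : volume Y ≠ 0)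
    (Φ : (Fin d → ℝ) → Sphere d)
    (hΦ : ∀ θ > (d : ℝ) / (d - β), ∃ C > 0, ∀ x ∈ Y, ∀ y ∈ Y,
      dist x y ^ θ ≤ C * dist (Φ x) (Φ y))
    (hgrowth : ∀ x ∈ Y, β ≤ growthExponent d f (Φ x)) :
    ENNReal.ofReal (d - β) ≤ dimH (levelSet d β f) := by
  have hd0 : (0 : ℝ) < d := by exact_mod_cast hd
  have hs : 0 < (d : ℝ) - β := sub_pos.2 hβd
  set Z : ℕ → Set (Fin d → ℝ) := fun k =>
    {x ∈ Y | ((β + (d - β) / (k + 2) : ℝ) : EReal) < growthExponent d f (Φ x)} with hZ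
  -- With η = (d-β)/(k+2), the image of `Z k` has dimension at most d-β-η. Pulling back costs a
  -- factor θ, and θ(d-β-η) < d for θ close to d/(d-β), so `Z k` cannot have positive volume.
  have hZ0 : ∀ k, volume (Z k) = 0 := by
    intro k
    by_contra hne
    set η : ℝ := (d - β) / (k + 2) with hη
    have hη0 : 0 < η := by positivity
    have hη1 : η < d - β := by
      rw [hη, div_lt_iff₀ (by positivity)]
      nlinarith [Nat.cast_nonneg (α := ℝ) k]
    have h1 := le_dimH_of_volume_ne_zero hne
    have hlt : (d : ℝ) / (d - β) < d / (d - β - η) :=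
      div_lt_div_of_pos_left hd0 (by linarith) (by linarith)
    obtain ⟨θ, hθ1, hθ2⟩ := exists_between hlt
    have hθ0 : 0 < θ := lt_trans (by positivity) hθ1
    obtain ⟨C, hC, hCY⟩ := hΦ θ hθ1
    have h2 := dimH_le_mul_dimH_image (S := Z k) hθ0 hC
      (fun x hx y hy => hCY x hx.1 y hy.1)
    have h3 : dimH (Φ '' Z k) ≤ ENNReal.ofReal (d - (β + η)) := by
      refine (dimH_mono ?_).trans (dimH_growthExponent_gt_le f (γ := β + η) (by linarith)
        (by linarith))
      rintro _ ⟨x, hx, rfl⟩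
      exact hx.2
    have h4 : (d : ENNReal) ≤ ENNReal.ofReal (θ * (d - (β + η))) := by
      rw [ENNReal.ofReal_mul hθ0.le]
      exact h1.trans (h2.trans (by gcongr))
    rw [← ENNReal.ofReal_natCast, ENNReal.ofReal_le_ofReal_iff
      (mul_nonneg hθ0.le (by linarith))] at h4
    rw [lt_div_iff₀ (by linarith)] at hθ2
    linarith [show d - (β + η) = d - β - η by ring]
  set X := Y \ ⋃ k, Z k with hX
  have hX0 : volume X ≠ 0 := by
    rwa [hX, measure_sdiff_null (measure_iUnion_null hZ0)]
  have hlevel : Φ '' X ⊆ levelSet d β f := by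
    rintro _ ⟨x, ⟨hxY, hxZ⟩, rfl⟩
    refine le_antisymm ?_ (hgrowth x hxY)
    have hlim : Tendsto (fun k : ℕ => ((β + (d - β) / (k + 2) : ℝ) : EReal)) atTop
        (𝓝 (β : EReal)) := by
      rw [EReal.tendsto_coe]
      have h1 : Tendsto (fun n : ℕ => (d - β) / ((n : ℝ) + 2)) atTop (𝓝 0) :=
        tendsto_const_nhds.div_atTop
          (tendsto_atTop_add_const_right _ _ tendsto_natCast_atTop_atTop)
      simpa using h1.const_add β
    refine ge_of_tendsto' hlim fun k => ?_
    by_contra! hlt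
    exact hxZ (mem_iUnion.2 ⟨k, hxY, hlt⟩)
  refine le_trans ?_ (dimH_mono hlevel)
  have hmain : ∀ θ > (d : ℝ) / (d - β), ENNReal.ofReal (d / θ) ≤ dimH (Φ '' X) := by
    intro θ hθ
    have hθ0 : 0 < θ := lt_trans (by positivity) hθ
    obtain ⟨C, hC, hCY⟩ := hΦ θ hθ
    have h2 := (le_dimH_of_volume_ne_zero hX0).trans
      (dimH_le_mul_dimH_image (S := X) hθ0 hC (fun x hx y hy => hCY x hx.1 y hy.1))
    rw [ENNReal.ofReal_div_of_pos hθ0, ENNReal.ofReal_natCast]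
    refine ENNReal.div_le_of_le_mul ?_
    rwa [mul_comm]
  have hlim : Tendsto (fun θ : ℝ => ENNReal.ofReal (d / θ)) (𝓝[>] ((d : ℝ) / (d - β)))
      (𝓝 (ENNReal.ofReal (d - β))) := by
    refine ENNReal.tendsto_ofReal ?_
    have hne : (d : ℝ) / (d - β) ≠ 0 := by positivity
    have h1 : Tendsto (fun θ : ℝ => (d : ℝ) / θ) (𝓝 ((d : ℝ) / (d - β)))
        (𝓝 ((d : ℝ) / (d / (d - β)))) := tendsto_const_nhds.div tendsto_id hne
    rw [div_div_cancel₀ hd0.ne'] at h1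
    exact h1.mono_left nhdsWithin_le_nhds
  exact le_of_tendsto hlim (eventually_mem_nhdsWithin.mono fun θ hθ => hmain θ hθ)

end BallPoisson

end

/-! ### Generic functions: positive exponents -/

noncomputable section

namespace BallPoisson

variable {𝕜 : Type*} [RCLike 𝕜] {d : ℕ}

/-- If the sets `G n` accumulate everywhere, then a generic point is `ε n`-close to `G n` for
infinitely many `n`. -/
theorem eventually_residual_exists_dist_lt {X : Type*} [PseudoMetricSpace X] [BaireSpace X]
    (G : ℕ → Set X) {ε : ℕ → ℝ} (hε : ∀ n, 0 < ε n)
    (hG : ∀ x, ∀ r > 0, ∀ N, ∃ n ≥ N, ∃ g ∈ G n, dist g x < r) :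
    ∀ᶠ f in residual X, ∀ N, ∃ n ≥ N, ∃ g ∈ G n, dist f g < ε n := by
  refine eventually_countable_forall.2 fun N => ?_
  have heq : {f | ∃ n ≥ N, ∃ g ∈ G n, dist f g < ε n} =
      ⋃ n ≥ N, ⋃ g ∈ G n, Metric.ball g (ε n) := by
    ext f
    simp
  refine residual_of_dense_open (s := {f | ∃ n ≥ N, ∃ g ∈ G n, dist f g < ε n}) ?_ ?_
  · rw [heq]
    exact isOpen_biUnion fun n _ => isOpen_biUnion fun g _ => Metric.isOpen_ball
  · refine Metric.dense_iff.2 fun x r hr => ?_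
    obtain ⟨n, hn, g, hg, hgx⟩ := hG x r hr N
    exact ⟨g, hgx, n, hn, g, hg, by rw [dist_self]; exact hε n⟩

/-- The half-open unit cube. -/
def unitCube (d : ℕ) : Set (Fin d → ℝ) := univ.pi fun _ => Ico (0 : ℝ) 1

theorem volume_unitCube (d : ℕ) : volume (unitCube d) = 1 := by
  simp [unitCube, Real.volume_pi_Ico]

theorem measurableSet_unitCube (d : ℕ) : MeasurableSet (unitCube d) :=
  MeasurableSet.univ_pi fun _ => measurableSet_Ico

theorem tendsto_add_one_mul_pow {r : ℝ} (hr0 : 0 ≤ r) (hr1 : r < 1) :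
    Tendsto (fun n : ℕ => ((n : ℝ) + 1) * r ^ n) atTop (𝓝 0) := by
  have h1 := (tendsto_self_mul_const_pow_of_lt_one hr0 hr1).add
    (tendsto_pow_atTop_nhds_zero_of_lt_one hr0 hr1)
  rw [add_zero] at h1
  exact h1.congr fun n => by ring

theorem tendsto_add_one_sq_mul_pow {r : ℝ} (hr0 : 0 ≤ r) (hr1 : r < 1) :
    Tendsto (fun n : ℕ => ((n : ℝ) + 1) ^ 2 * r ^ n) atTop (𝓝 0) := by
  have h1 := (tendsto_add_one_mul_pow (Real.sqrt_nonneg r)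
    ((Real.sqrt_lt' one_pos).2 (by simpa using hr1))).pow 2
  rw [zero_pow two_ne_zero] at h1
  refine h1.congr fun n => ?_
  rw [mul_pow, ← pow_mul, mul_comm n 2, pow_mul, Real.sq_sqrt hr0]

/-- This will serve with b = 2^(αβ) and b' = 2^(αβ'): the comb, even divided by n+1, beats the
target growth plus the bounded part and the error. -/
theorem eventually_pow_add_le_div {b b' c : ℝ} (hb' : 0 < b') (hbb' : b' < b) (hb : 1 < b)
    (hc : 0 < c) : ∀ᶠ n : ℕ in atTop, b' ^ n + (n + 1) ≤ c / (n + 1) * b ^ n := by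
  have hb0 : 0 < b := by linarith
  have h1 := (tendsto_add_one_mul_pow (r := b' / b) (by positivity) ((div_lt_one hb0).2 hbb')).add
    (tendsto_add_one_sq_mul_pow (r := 1 / b) (by positivity) ((div_lt_one hb0).2 hb))
  rw [add_zero] at h1
  filter_upwards [h1.eventually (gt_mem_nhds hc)] with n hn
  rw [div_pow, div_pow, one_pow] at hn
  have hbn : 0 < b ^ n := by positivity
  have h2 : (b' ^ n + (n + 1)) = (((n : ℝ) + 1) * (b' ^ n / b ^ n) + ((n : ℝ) + 1) ^ 2 * (1 / b ^ n)) / (n + 1) * b ^ n := by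
    field_simp
  rw [h2]
  gcongr

variable (𝕜) in
/-- Perturbations by a small multiple of `dyadicComb 𝕜 d n` of functions whose Poisson integral is
bounded by `n`. -/
def combPerturbation (d n : ℕ) : Set (Lp 𝕜 1 (surfaceMeasure d)) :=
  {u | ∃ g : Lp 𝕜 1 (surfaceMeasure d), (∀ (y : Sphere d) (δ : ℝ), 0 < δ → δ ≤ 1 →
    ‖poissonIntegral d g ((1 - δ) • (y : EuclideanSpace ℝ (Fin (d + 1))))‖ ≤ n) ∧
    u = g + ((1 / ((n : ℝ) + 1) : ℝ) : 𝕜) • dyadicComb 𝕜 d n}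

theorem norm_smul_dyadicComb_le (d n : ℕ) :
    ‖((1 / ((n : ℝ) + 1) : ℝ) : 𝕜) • dyadicComb 𝕜 d n‖ ≤ 1 / ((n : ℝ) + 1) := by
  rw [norm_smul, RCLike.norm_ofReal, abs_of_pos (by positivity)]
  exact mul_le_of_le_one_right (by positivity) (norm_dyadicComb_le d n)

/-- Continuous functions are dense in L¹ and have bounded Poisson integrals, while the scaled comb
has norm at most 1/(n+1). -/
theorem exists_combPerturbation_dist_lt (x : Lp 𝕜 1 (surfaceMeasure d)) {r : ℝ} (hr : 0 < r)
    (N : ℕ) : ∃ n ≥ N, ∃ g ∈ combPerturbation 𝕜 d n, dist g x < r := by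
  obtain ⟨g, hg⟩ := (ContinuousMap.toLp_denseRange 𝕜 (surfaceMeasure d) 𝕜
    ENNReal.one_ne_top).exists_dist_lt x (half_pos hr)
  obtain ⟨M, hM⟩ := exists_norm_poissonIntegral_toLp_le (𝕜 := 𝕜) g
  have hev := (tendsto_one_div_add_atTop_nhds_zero_nat (𝕜 := ℝ)).eventually
    (gt_mem_nhds (half_pos hr))
  obtain ⟨n, hn1, hn2, hn3⟩ := (hev.and ((eventually_ge_atTop N).and
    (tendsto_natCast_atTop_atTop.eventually (eventually_ge_atTop M)))).exists
  refine ⟨n, hn2, _, ⟨ContinuousMap.toLp 1 (surfaceMeasure d) 𝕜 g,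
    fun y δ h0 h1 => (hM y δ h0 h1).trans hn3, rfl⟩, ?_⟩
  rw [dist_comm] at hg
  rw [dist_eq_norm] at hg ⊢
  rw [add_sub_right_comm]
  refine (norm_add_le _ _).trans_lt ?_
  linarith [norm_smul_dyadicComb_le (𝕜 := 𝕜) d n]

/-- The subtracted n+1 is n for the bounded part and 1 for the distance to the perturbation, which
is below δ^(d+1) at every depth δ ≥ 2^(-n²). -/
theorem le_norm_poissonIntegral_of_dist_combPerturbation_lt {f u : Lp 𝕜 1 (surfaceMeasure d)}
    {n : ℕ} (hu : u ∈ combPerturbation 𝕜 d n) (hfu : dist f u < ((1 / 2) ^ n ^ 2) ^ (d + 1))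
    {x : Fin d → ℝ} (j : Fin d → Fin (2 ^ n)) {δ : ℝ} (hδ : (1 / 2) ^ n ^ 2 ≤ δ) (hδ1 : δ ≤ 1)
    (hx : dist x (dyadicPoint j) ≤ δ) :
    ((2 * d + 4 : ℝ) ^ (d + 1))⁻¹ / (n + 1) * ((1 / 2) ^ (n * d) * (δ ^ d)⁻¹) - (n + 1) ≤
      ‖poissonIntegral d f ((1 - δ) • (gnomonic x : EuclideanSpace ℝ (Fin (d + 1))))‖ := by
  obtain ⟨g, hg, rfl⟩ := hu
  have hδ0 : 0 < δ := lt_of_lt_of_le (by positivity) hδ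
  have hcomb := le_norm_poissonIntegral_dyadicComb (𝕜 := 𝕜) j hδ hδ1 hx
  have hgn := hg (gnomonic x) δ hδ0 hδ1
  set z := (1 - δ) • (gnomonic x : EuclideanSpace ℝ (Fin (d + 1))) with hz
  have hzn : ‖z‖ = 1 - δ := norm_smul_sphere _ (by linarith)
  have hz1 : ‖z‖ < 1 := by linarith
  set h := ((1 / ((n : ℝ) + 1) : ℝ) : 𝕜) • dyadicComb 𝕜 d n with hh
  have herr : ‖poissonIntegral d (f - (g + h)) z‖ ≤ 1 := by
    refine (norm_poissonIntegral_le _ hδ0 hzn.le).trans ?_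
    rw [inv_mul_le_iff₀ (by positivity), mul_one, ← dist_eq_norm]
    exact hfu.le.trans (pow_le_pow_left₀ (by positivity) hδ _)
  have heq : poissonIntegral d h z =
      poissonIntegral d f z - poissonIntegral d g z - poissonIntegral d (f - (g + h)) z := by
    rw [poissonIntegral_sub _ _ hz1, poissonIntegral_add _ _ hz1]
    ring
  have hnorm : ‖poissonIntegral d h z‖ =
      1 / ((n : ℝ) + 1) * ‖poissonIntegral d (dyadicComb 𝕜 d n) z‖ := by
    rw [hh, poissonIntegral_smul, norm_mul, RCLike.norm_ofReal, abs_of_pos (by positivity)]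
  have htri : ‖poissonIntegral d h z‖ ≤ ‖poissonIntegral d f z‖ + n + 1 := by
    rw [heq]
    refine (norm_sub_le _ _).trans (add_le_add ((norm_sub_le _ _).trans ?_) herr)
    linarith
  have h1 := mul_le_mul_of_nonneg_left hcomb (by positivity : 0 ≤ 1 / ((n : ℝ) + 1))
  rw [← hnorm] at h1
  have h2 : ((2 * d + 4 : ℝ) ^ (d + 1))⁻¹ / (n + 1) * ((1 / 2) ^ (n * d) * (δ ^ d)⁻¹) =
      1 / ((n : ℝ) + 1) * (((2 * d + 4 : ℝ) ^ (d + 1))⁻¹ * (1 / 2) ^ (n * d) * (δ ^ d)⁻¹) := by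
    ring
  linarith

theorem le_dimH_levelSet_of_pos (hd : 1 ≤ d) {f : Lp 𝕜 1 (surfaceMeasure d)}
    (hf : ∀ N, ∃ n ≥ N, ∃ g ∈ combPerturbation 𝕜 d n, dist f g < ((1 / 2) ^ n ^ 2) ^ (d + 1))
    {β : ℝ} (hβ : 0 < β) (hβd : β < d) : ENNReal.ofReal (d - β) ≤ dimH (levelSet d β f) := by
  have hd0 : (0 : ℝ) < d := by exact_mod_cast hd
  have hs : 0 < (d : ℝ) - β := sub_pos.2 hβd
  set α : ℝ := d / (d - β) with hα
  have hα1 : 1 ≤ α := by rw [hα, le_div_iff₀ hs]; linarith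
  -- This identity turns 2^(-nd) δ^(-d) into δ^(-β) at δ = 2^(-αn).
  have hαβ : α * d - d = α * β := by rw [hα]; field_simp; ring
  set I : Set ℕ := {n | ∃ g ∈ combPerturbation 𝕜 d n, dist f g < ((1 / 2) ^ n ^ 2) ^ (d + 1)}
  have hI : I.Infinite := by
    refine infinite_of_forall_exists_gt fun N => ?_
    obtain ⟨n, hn, h⟩ := hf (N + 1)
    exact ⟨n, h, hn⟩
  obtain ⟨T, hT, hTexp, hTI⟩ := exists_dyadic_approximable_map hI hα1
  have hcube : ∀ x ∈ unitCube d, ∀ i, x i ∈ Ico (0 : ℝ) 1 := fun x hx i => hx i (mem_univ i)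
  refine le_dimH_levelSet hd hβd hβ.le f (Y := unitCube d) (by simp [volume_unitCube])
    (fun x => gnomonic fun i => T (x i)) (fun θ hθ => ?_) (fun x hx => ?_)
  · obtain ⟨C, hC, hCT⟩ := hTexp θ hθ
    have hθ0 : 0 < θ := by
      have : α < θ := hθ
      linarith
    refine ⟨C * (2 * (d + 1) ^ 2), by positivity, fun x hx y hy => ?_⟩
    set D := dist (fun i => T (x i)) (fun i => T (y i)) with hD
    have hD0 : 0 ≤ D := dist_nonneg
    have h1 : dist x y ≤ (C * D) ^ θ⁻¹ := by
      refine (dist_pi_le_iff (by positivity)).2 fun i => ?_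
      have h2 := hCT _ (hcube x hx i) _ (hcube y hy i)
      have h3 : |T (x i) - T (y i)| ≤ D := dist_le_pi_dist (fun i => T (x i)) (fun i => T (y i)) i
      rw [Real.dist_eq]
      rw [Real.le_rpow_inv_iff_of_pos (abs_nonneg _) (by positivity) hθ0]
      exact h2.trans (by gcongr)
    rw [Real.le_rpow_inv_iff_of_pos dist_nonneg (by positivity) hθ0] at h1
    refine h1.trans ?_
    rw [mul_assoc]
    refine mul_le_mul_of_nonneg_left ?_ hC.le
    exact dist_le_dist_gnomonic (fun i => hT _ (hcube x hx i)) (fun i => hT _ (hcube y hy i))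
  · refine le_growthExponent_of_forall_exists fun β' hβ' δ₀ hδ₀ => ?_
    have hev1 : ∀ᶠ n : ℕ in atTop, ((1 / 2 : ℝ) ^ α) ^ n < δ₀ :=
      (tendsto_pow_atTop_nhds_zero_of_lt_one (by positivity)
        (Real.rpow_lt_one (by norm_num) (by norm_num) (by linarith))).eventually (gt_mem_nhds hδ₀)
    have hev2 := eventually_pow_add_le_div (b := 2 ^ (α * β)) (b' := 2 ^ (α * β'))
      (c := ((2 * d + 4 : ℝ) ^ (d + 1))⁻¹) (by positivity)
      (Real.rpow_lt_rpow_of_exponent_lt (by norm_num) (by nlinarith))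
      (Real.one_lt_rpow (by norm_num) (by positivity)) (by positivity)
    obtain ⟨N, hN⟩ := eventually_atTop.1 (hev1.and (hev2.and ((eventually_ge_atTop 1).and
      (tendsto_natCast_atTop_atTop.eventually (eventually_ge_atTop α)))))
    obtain ⟨n, ⟨g, hg, hfg⟩, hNn, hdy⟩ := hTI N
    obtain ⟨hn1, hn2, hn3, hn4⟩ := hN n hNn
    have hn0 : (1 : ℝ) ≤ n := by exact_mod_cast hn3
    set δ : ℝ := (1 / 2 : ℝ) ^ (α * n) with hδ
    have hδ0 : 0 < δ := by positivity
    have hδlt : δ < 1 := Real.rpow_lt_one (by norm_num) (by norm_num) (by positivity)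
    -- Caps of radius 2^(-n²) are finer than 2^(-αn) once n ≥ α; this lets the same combs serve
    -- every β.
    have hδ1 : (1 / 2 : ℝ) ^ n ^ 2 ≤ δ := by
      rw [← Real.rpow_natCast]
      refine Real.rpow_le_rpow_of_exponent_ge (by norm_num) (by norm_num) ?_
      push_cast
      nlinarith
    choose j hj hj' using fun i => hdy (x i) (hcube x hx i)
    have hnear : dist (fun i => T (x i)) (dyadicPoint fun i => (⟨j i, hj i⟩ : Fin (2 ^ n))) ≤ δ :=
      (dist_pi_le_iff hδ0.le).2 fun i => hj' i
    refine ⟨δ, hδ0, ?_, hδlt, ?_⟩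
    · rwa [hδ, Real.rpow_mul (by norm_num), Real.rpow_natCast]
    · have h1 := le_norm_poissonIntegral_of_dist_combPerturbation_lt hg hfg _ hδ1 hδlt.le hnear
      refine le_trans ?_ h1
      have hpow : ∀ s : ℝ, δ ^ (-s) = (2 ^ (α * s)) ^ n := by
        intro s
        rw [hδ, ← Real.rpow_mul (by norm_num), one_div, Real.inv_rpow (by norm_num),
          ← Real.rpow_neg (by norm_num), ← Real.rpow_natCast, ← Real.rpow_mul (by norm_num)]
        congr 1
        ring
      have h2 : (1 / 2 : ℝ) ^ (n * d) * (δ ^ d)⁻¹ = (2 ^ (α * β)) ^ n := by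
        have h3 : (1 / 2 : ℝ) ^ (n * d) = ((2 ^ d) ^ n)⁻¹ := by
          rw [one_div, inv_pow, ← pow_mul, mul_comm]
        rw [← Real.rpow_natCast δ d, ← Real.rpow_neg hδ0.le, hpow, ← hαβ,
          Real.rpow_sub (by norm_num), Real.rpow_natCast 2 d, h3, div_pow, div_eq_inv_mul]
      rw [hpow, h2]
      linarith

/-! ### Generic functions: exponent zero -/

/-- The points of the cube at which `P[f]` is at least `c` in absolute value on the sphere of radius
`1 - 2 ^ (-n)`. -/
def largeSet (f : Lp 𝕜 1 (surfaceMeasure d)) (n : ℕ) (c : ℝ) : Set (Fin d → ℝ) :=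
  {x ∈ unitCube d | c ≤ ‖poissonIntegral d f
    ((1 - (1 / 2 : ℝ) ^ n) • (gnomonic x : EuclideanSpace ℝ (Fin (d + 1))))‖}

/-- Needed for continuity from above of the volume; it follows from joint measurability of the
integrand. -/
theorem measurableSet_largeSet (f : Lp 𝕜 1 (surfaceMeasure d)) (n : ℕ) (c : ℝ) :
    MeasurableSet (largeSet f n c) := by
  suffices h : StronglyMeasurable fun x : Fin d → ℝ => poissonIntegral d f
      ((1 - (1 / 2 : ℝ) ^ n) • (gnomonic x : EuclideanSpace ℝ (Fin (d + 1)))) by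
    have heq : largeSet f n c = unitCube d ∩ {x | c ≤ ‖poissonIntegral d f
        ((1 - (1 / 2 : ℝ) ^ n) • (gnomonic x : EuclideanSpace ℝ (Fin (d + 1))))‖} := by
      ext x
      exact Iff.rfl
    rw [heq]
    exact (measurableSet_unitCube d).inter (measurableSet_le measurable_const h.norm.measurable)
  have hg : Continuous fun p : (Fin d → ℝ) × Sphere d =>
      (gnomonic p.1 : EuclideanSpace ℝ (Fin (d + 1))) :=
    continuous_subtype_val.comp (continuous_gnomonic.comp continuous_fst)
  have h1 : Measurable fun p : (Fin d → ℝ) × Sphere d =>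
      (1 - (1 / 2 : ℝ) ^ n) • (gnomonic p.1 : EuclideanSpace ℝ (Fin (d + 1))) :=
    (hg.const_smul (1 - (1 / 2 : ℝ) ^ n)).measurable
  have h2 : Measurable fun p : (Fin d → ℝ) × Sphere d =>
      (p.2 : EuclideanSpace ℝ (Fin (d + 1))) := (by fun_prop : Continuous _).measurable
  have h3 : Measurable fun p : (Fin d → ℝ) × Sphere d => poissonKernel d
      ((1 - (1 / 2 : ℝ) ^ n) • (gnomonic p.1 : EuclideanSpace ℝ (Fin (d + 1)))) p.2 := by
    unfold poissonKernel
    exact (measurable_const.sub (h1.norm.pow_const 2)).div ((h1.sub h2).norm.pow_const _)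
  have h4 : StronglyMeasurable fun p : (Fin d → ℝ) × Sphere d => poissonKernel d
      ((1 - (1 / 2 : ℝ) ^ n) • (gnomonic p.1 : EuclideanSpace ℝ (Fin (d + 1)))) p.2 • f p.2 :=
    h3.stronglyMeasurable.smul ((Lp.stronglyMeasurable f).comp_measurable measurable_snd)
  unfold poissonIntegral
  exact h4.integral_prod_right'

theorem exists_dyadicPoint_near (n : ℕ) {x : Fin d → ℝ} (hx : x ∈ unitCube d) :
    ∃ j : Fin d → Fin (2 ^ n), dist x (dyadicPoint j) ≤ (1 / 2) ^ n := by
  have hx' : ∀ i, x i ∈ Ico (0 : ℝ) 1 := fun i => hx i (mem_univ i)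
  have h2 : (0 : ℝ) < 2 ^ n := by positivity
  have hlt : ∀ i, ⌊2 ^ n * x i⌋₊ < 2 ^ n := fun i => by
    rw [Nat.floor_lt (mul_nonneg h2.le (hx' i).1)]
    push_cast
    nlinarith [(hx' i).2]
  refine ⟨fun i => ⟨⌊2 ^ n * x i⌋₊, hlt i⟩, (dist_pi_le_iff (by positivity)).2 fun i => ?_⟩
  have h3 := Nat.floor_le (mul_nonneg h2.le (hx' i).1)
  have h4 := Nat.lt_floor_add_one (2 ^ n * x i)
  have h5 : x i - (⌊2 ^ n * x i⌋₊ : ℝ) * (1 / 2) ^ n =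
      (2 ^ n * x i - ⌊2 ^ n * x i⌋₊) * (1 / 2) ^ n := by
    rw [sub_mul, mul_right_comm, ← mul_pow]
    norm_num
  change |x i - (⌊2 ^ n * x i⌋₊ : ℝ) * (1 / 2) ^ n| ≤ _
  rw [h5, abs_of_nonneg (mul_nonneg (by linarith) (by positivity))]
  exact mul_le_of_le_one_left (by positivity) (by linarith)

variable (𝕜) in
/-- The functions whose Poisson integral is not small on most of the sphere of radius
`1 - 2 ^ (-n)`. -/
def mostlyLarge (d n : ℕ) : Set (Lp 𝕜 1 (surfaceMeasure d)) :=
  {g | 1 / 2 ≤ volume (largeSet g n (((2 * d + 4 : ℝ) ^ (d + 1))⁻¹ / (2 * (n + 1))))}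

/-- At depth 2^(-n) the scaled comb has Poisson integral at least c/(n+1) over the whole cube. At
each point either `x` or `x + h` therefore reaches half of this, and one of the two does so on
volume at least 1/2. -/
theorem exists_mostlyLarge_dist_lt (x : Lp 𝕜 1 (surfaceMeasure d)) {r : ℝ} (hr : 0 < r)
    (N : ℕ) : ∃ n ≥ N, ∃ g ∈ mostlyLarge 𝕜 d n, dist g x < r := by
  obtain ⟨n, hn1, hn2⟩ := ((tendsto_one_div_add_atTop_nhds_zero_nat (𝕜 := ℝ)).eventually
    (gt_mem_nhds hr) |>.and (eventually_ge_atTop N)).exists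
  refine ⟨n, hn2, ?_⟩
  set h := ((1 / ((n : ℝ) + 1) : ℝ) : 𝕜) • dyadicComb 𝕜 d n with hh
  set c := ((2 * d + 4 : ℝ) ^ (d + 1))⁻¹ with hc
  have hcov : unitCube d ⊆ largeSet x n (c / (2 * (n + 1))) ∪
      largeSet (x + h) n (c / (2 * (n + 1))) := by
    intro t ht
    obtain ⟨j, hj⟩ := exists_dyadicPoint_near n ht
    have hδ1 : ((1 : ℝ) / 2) ^ n ≤ 1 := pow_le_one₀ (by norm_num) (by norm_num)
    have hcomb := le_norm_poissonIntegral_dyadicComb (𝕜 := 𝕜) j (δ := (1 / 2) ^ n)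
      (pow_le_pow_of_le_one (by norm_num) (by norm_num) (Nat.le_self_pow two_ne_zero n)) hδ1 hj
    by_contra! hnot
    rw [mem_union, not_or] at hnot
    have h1 := not_le.1 fun h => hnot.1 ⟨ht, h⟩
    have h2 := not_le.1 fun h => hnot.2 ⟨ht, h⟩
    set z := (1 - (1 / 2 : ℝ) ^ n) • (gnomonic t : EuclideanSpace ℝ (Fin (d + 1))) with hz
    have hzn : ‖z‖ = 1 - (1 / 2 : ℝ) ^ n := norm_smul_sphere _ (by linarith)
    have hz1 : ‖z‖ < 1 := by
      have : (0 : ℝ) < (1 / 2) ^ n := by positivity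
      linarith
    have h3 : poissonIntegral d h z = poissonIntegral d (x + h) z - poissonIntegral d x z := by
      rw [poissonIntegral_add _ _ hz1]
      ring
    have h4 : ‖poissonIntegral d h z‖ =
        1 / ((n : ℝ) + 1) * ‖poissonIntegral d (dyadicComb 𝕜 d n) z‖ := by
      rw [hh, poissonIntegral_smul, norm_mul, RCLike.norm_ofReal, abs_of_pos (by positivity)]
    have h5 := norm_sub_le (poissonIntegral d (x + h) z) (poissonIntegral d x z)
    rw [← h3, h4] at h5
    rw [← pow_mul, mul_assoc, mul_inv_cancel₀ (by positivity), mul_one, ← hc] at hcomb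
    have h6 := mul_le_mul_of_nonneg_left hcomb (by positivity : 0 ≤ 1 / ((n : ℝ) + 1))
    have h7 : 1 / ((n : ℝ) + 1) * c = c / (2 * (n + 1)) + c / (2 * (n + 1)) := by
      field_simp
      norm_num
    linarith
  have hvol : 1 ≤ volume (largeSet x n (c / (2 * (n + 1)))) +
      volume (largeSet (x + h) n (c / (2 * (n + 1)))) :=
    (volume_unitCube d).symm.le.trans ((measure_mono hcov).trans (measure_union_le _ _))
  rcases le_or_gt (1 / 2) (volume (largeSet x n (c / (2 * (n + 1))))) with hx | hx
  · exact ⟨x, hx, by rwa [dist_self]⟩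
  · refine ⟨x + h, ?_, ?_⟩
    · change 1 / 2 ≤ volume (largeSet (x + h) n (c / (2 * (n + 1))))
      by_contra! hlt
      have := ENNReal.add_lt_add hx hlt
      rw [ENNReal.add_halves] at this
      exact absurd hvol (not_le.2 this)
    · rw [dist_eq_norm, add_sub_cancel_left]
      exact (norm_smul_dyadicComb_le d n).trans_lt hn1

theorem le_dimH_levelSet_zero (hd : 1 ≤ d) {f : Lp 𝕜 1 (surfaceMeasure d)}
    (hf : ∀ N, ∃ n ≥ N, ∃ g ∈ mostlyLarge 𝕜 d n, dist f g <
      ((1 / 2) ^ n) ^ (d + 1) * (((2 * d + 4 : ℝ) ^ (d + 1))⁻¹ / (4 * (n + 1)))) :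
    ENNReal.ofReal (d - 0) ≤ dimH (levelSet d 0 f) := by
  have hd0 : (0 : ℝ) < d := by exact_mod_cast hd
  set c := ((2 * d + 4 : ℝ) ^ (d + 1))⁻¹ with hc
  have hc0 : 0 < c := by positivity
  set B : ℕ → Set (Fin d → ℝ) := fun n => largeSet f n (c / (4 * (n + 1))) with hB
  have hBvol : ∀ N, ∃ n ≥ N, 1 / 2 ≤ volume (B n) := by
    intro N
    obtain ⟨n, hn, g, hg, hfg⟩ := hf N
    refine ⟨n, hn, le_trans hg (measure_mono fun t ht => ⟨ht.1, ?_⟩)⟩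
    have hδ1 : ((1 : ℝ) / 2) ^ n ≤ 1 := pow_le_one₀ (by norm_num) (by norm_num)
    have hδ0 : (0 : ℝ) < (1 / 2) ^ n := by positivity
    have h1 := ht.2
    set z := (1 - (1 / 2 : ℝ) ^ n) • (gnomonic t : EuclideanSpace ℝ (Fin (d + 1))) with hz
    have hzn : ‖z‖ = 1 - (1 / 2 : ℝ) ^ n := norm_smul_sphere _ (by linarith)
    have h2 : ‖poissonIntegral d (f - g) z‖ ≤ c / (4 * (n + 1)) := by
      refine (norm_poissonIntegral_le _ hδ0 hzn.le).trans ?_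
      rw [inv_mul_le_iff₀ (by positivity), ← dist_eq_norm]
      exact hfg.le
    rw [poissonIntegral_sub _ _ (by linarith), norm_sub_rev] at h2
    have h3 := norm_sub_norm_le (poissonIntegral d g z) (poissonIntegral d f z)
    have h4 : c / (2 * ((n : ℝ) + 1)) = c / (4 * (n + 1)) + c / (4 * (n + 1)) := by
      field_simp
      norm_num
    linarith
  -- The intersection of the `S N` is the limsup of the `B n`; continuity from above keeps its
  -- volume at least 1/2.
  set S : ℕ → Set (Fin d → ℝ) := fun N => ⋃ n ≥ N, B n with hS
  have hSmeas : ∀ N, MeasurableSet (S N) := fun N =>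
    MeasurableSet.iUnion fun n => MeasurableSet.iUnion fun _ => measurableSet_largeSet _ _ _
  have hSsub : ∀ N, S N ⊆ unitCube d := fun N => iUnion₂_subset fun n _ x hx => hx.1
  have hSanti : Antitone S := fun M N hMN =>
    iUnion₂_subset fun n hn => subset_iUnion₂_of_subset n (le_trans hMN hn) Subset.rfl
  have hSvol : ∀ N, 1 / 2 ≤ volume (S N) := by
    intro N
    obtain ⟨n, hn, h⟩ := hBvol N
    exact h.trans (measure_mono (subset_iUnion₂_of_subset n hn Subset.rfl))
  have hYvol : 1 / 2 ≤ volume (⋂ N, S N) := by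
    refine ge_of_tendsto' (tendsto_measure_iInter_atTop (fun N => (hSmeas N).nullMeasurableSet)
      hSanti ⟨0, ?_⟩) hSvol
    refine ((measure_mono (hSsub 0)).trans_lt ?_).ne
    rw [volume_unitCube]
    exact ENNReal.one_lt_top
  have hYsub : ∀ x ∈ ⋂ N, S N, ∀ i, x i ∈ Ico (0 : ℝ) 1 := fun x hx i =>
    hSsub 0 (mem_iInter.1 hx 0) i (mem_univ i)
  refine le_dimH_levelSet hd hd0 le_rfl f (Y := ⋂ N, S N) ?_ gnomonic (fun θ hθ => ?_)
    (fun x hx => ?_)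
  · intro h0
    rw [h0] at hYvol
    simp at hYvol
  -- Here θ > 1 and distances in the cube are at most 1, so the Lipschitz inverse of the chart is
  -- enough.
  · rw [sub_zero, div_self hd0.ne'] at hθ
    refine ⟨2 * (d + 1) ^ 2, by positivity, fun x hx y hy => ?_⟩
    have hx' := hYsub x hx
    have hy' := hYsub y hy
    have h1 : dist x y ≤ 1 := (dist_pi_le_iff zero_le_one).2 fun i => by
      rw [Real.dist_eq, abs_le]
      constructor <;> linarith [(hx' i).1, (hx' i).2, (hy' i).1, (hy' i).2]
    refine le_trans ?_ (dist_le_dist_gnomonic (fun i => Ico_subset_Icc_self (hx' i))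
      (fun i => Ico_subset_Icc_self (hy' i)))
    simpa using Real.rpow_le_rpow_of_exponent_ge_of_imp dist_nonneg h1 hθ.le (by intros; linarith)
  · refine le_growthExponent_of_forall_exists fun β' hβ' δ₀ hδ₀ => ?_
    have hev1 : ∀ᶠ n : ℕ in atTop, (1 / 2 : ℝ) ^ n < δ₀ :=
      (tendsto_pow_atTop_nhds_zero_of_lt_one (by norm_num) (by norm_num)).eventually
        (gt_mem_nhds hδ₀)
    -- Since β' < 0, the required size (2^β')^n decays geometrically and falls below c/(4(n+1)).
    have hev2 := (tendsto_add_one_mul_pow (r := 2 ^ β') (by positivity)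
      (Real.rpow_lt_one_of_one_lt_of_neg (by norm_num) hβ')).eventually
      (gt_mem_nhds (by positivity : 0 < c / 4))
    obtain ⟨N, hN⟩ := eventually_atTop.1 (hev1.and (hev2.and (eventually_ge_atTop 1)))
    obtain ⟨n, hn, hxn⟩ := mem_iUnion₂.1 (mem_iInter.1 hx N)
    obtain ⟨hn1, hn2, hn3⟩ := hN n hn
    refine ⟨(1 / 2) ^ n, by positivity, hn1,
      pow_lt_one₀ (by norm_num) (by norm_num) (by omega), le_trans ?_ hxn.2⟩
    have h1 : (((1 : ℝ) / 2) ^ n) ^ (-β') = (2 ^ β') ^ n := by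
      rw [← Real.rpow_natCast, ← Real.rpow_natCast, ← Real.rpow_mul (by norm_num),
        ← Real.rpow_mul (by norm_num), one_div, Real.inv_rpow (by norm_num),
        ← Real.rpow_neg (by norm_num)]
      congr 1
      ring
    rw [h1, le_div_iff₀ (by positivity)]
    linarith

end BallPoisson

end

/-! ### Conclusion -/

theorem theorem2 (𝕜 : Type*) [RCLike 𝕜] (d : ℕ) (hd : 1 ≤ d) :
    ∀ᶠ f : Lp 𝕜 1 (BallPoisson.surfaceMeasure d) in
        residual (Lp 𝕜 1 (BallPoisson.surfaceMeasure d)),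
      ∀ β ∈ Icc (0 : ℝ) (d : ℝ),
        dimH (BallPoisson.levelSet d β f) = ENNReal.ofReal ((d : ℝ) - β) := by
  have h1 := BallPoisson.eventually_residual_exists_dist_lt (BallPoisson.combPerturbation 𝕜 d)
    (ε := fun n => ((1 / 2) ^ n ^ 2) ^ (d + 1)) (fun n => by positivity)
    (fun x r hr N => BallPoisson.exists_combPerturbation_dist_lt x hr N)
  have h2 := BallPoisson.eventually_residual_exists_dist_lt (BallPoisson.mostlyLarge 𝕜 d)
    (ε := fun n => ((1 / 2) ^ n) ^ (d + 1) * (((2 * d + 4 : ℝ) ^ (d + 1))⁻¹ / (4 * (n + 1))))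
    (fun n => by positivity) (fun x r hr N => BallPoisson.exists_mostlyLarge_dist_lt x hr N)
  filter_upwards [h1, h2] with f hf1 hf2 β hβ
  refine le_antisymm (BallPoisson.dimH_levelSet_le f hβ) ?_
  -- At β = d the lower bound is `ENNReal.ofReal 0`, which also allows an empty level set.
  rcases hβ.2.eq_or_lt with h | h
  · simp [h]
  · rcases hβ.1.eq_or_lt with h0 | h0
    · subst h0
      exact BallPoisson.le_dimH_levelSet_zero hd hf2
    · exact BallPoisson.le_dimH_levelSet_of_pos hd hf1 h0 h
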